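/- Let $V=\{v_1,v_2,v_3,x_1,x_2,x_3,y_1,y_2,y_3,z_1,z_2,z_3\}$ be a set of $12$ elements. Simplicial complexes are abstract; $\langle F_1,\dots,F_k\rangle$ is the complex of all subsets of the $F_i$, $K*L=\{F\cup G: F\in K,\ G\in L\}$ is the join, and $$\Diamond([p_1,p_2,p_3],[q_1,q_2,q_3])=\langle\{p_1\},\{q_1\}\rangle*\langle\{p_2\},\{q_2\}\rangle*\langle\{p_3\},\{q_3\}\rangle .$$ Define $$\Gamma_1=\langle\{v_1\}\rangle*\Diamond([x_1,x_2,x_3],[y_1,y_2,y_3])\ \cup\ \langle\{v_2\}\rangle*\Diamond([y_1,y_2,y_3],[z_1,z_2,z_3])\ \cup\ \langle\{v_3\}\rangle*\Diamond([x_1,x_2,x_3],[z_3,z_1,z_2]).$$ Let $F$ be the following set of nine $4$-element sets (written as strings), a triangulation of the product of the triangle $abc$ with a $3$-cycle $123$: $$a_1b_1c_1c_2,\ a_1b_1b_2c_2,\ a_1a_2b_2c_2,\ a_2b_2c_2c_3,\ a_2b_2b_3c_3,\ a_2a_3b_3c_3,\ a_3b_3c_3c_1,\ a_3b_3b_1c_1,\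 a_3a_1b_1c_1,$$ and let $\varphi$ be the map $a_1,a_2,a_3\mapsto z_2,z_3,z_1$; $b_1,b_2,b_3\mapsto y_3,y_1,y_2$; $c_1,c_2,c_3\mapsto x_1,x_2,x_3$. Define $\Gamma_2=\langle\varphi(G): G\in F\rangle$ and $\Delta_{12,33}=\Gamma_1\cup\Gamma_2$. For $i=1,2$ let the boundary complex $\partial\Gamma_i$ be the complex generated by the faces of codimension one that are contained in exactly one facet of $\Gamma_i$. **Theorem.** $\Delta_{12,33}$ is a flag simplicial $3$-sphere: its geometric realization is homeomorphic to $\mathbb S^3$, and every minimal non-face of $\Delta_{12,33}$ (a subset of $V$ that is not a face and does not properly contain another non-face) has cardinality $2$. Moreover, the geometric realizations of $\Gamma_1$ and $\Gamma_2$ are both homeomorphic to the solid torus $\mathbb D^2\times\mathbb S^1$, one has $\Gamma_1\cap\Gamma_2=\partial\Gamma_1=\partial\Gamma_2$, and $\Delta_{12,33}$ has exactly $12$ vertices and exactly $33$ facets. -/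

import Mathlib

/-! Abstract simplicial complexes are Mathlib's `PreAbstractSimplicialComplex V`: the faces are
the nonempty ones, and the empty face (which belongs to every complex in the usual convention) is
left implicit. -/

namespace PreAbstractSimplicialComplex

variable {V : Type*}

/-- The complex generated by a family `S` of finite sets: its faces are the nonempty subsets of
the members of `S`. -/
def generate (S : Set (Finset V)) : PreAbstractSimplicialComplex V where
  faces := {s | s.Nonempty ∧ ∃ F ∈ S, s ⊆ F}
  isRelLowerSet_faces := by
    rintro s ⟨hs, F, hF, hsF⟩
    exact ⟨hs, fun t hts ht => ⟨ht, F, hF, hts.trans hsF⟩⟩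

/-- The simplicial join: its faces are the nonempty unions of a (possibly empty) face of `K` and a
(possibly empty) face of `L`. -/
def join [DecidableEq V] (K L : PreAbstractSimplicialComplex V) :
    PreAbstractSimplicialComplex V where
  faces := {s | s.Nonempty ∧ ∃ F G : Finset V, (F = ∅ ∨ F ∈ K) ∧ (G = ∅ ∨ G ∈ L) ∧ s = F ∪ G}
  isRelLowerSet_faces := by
    have key : ∀ (M : PreAbstractSimplicialComplex V) (F t : Finset V),
        (F = ∅ ∨ F ∈ M) → (F ∩ t = ∅ ∨ F ∩ t ∈ M) := by
      intro M F t hF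
      rcases Finset.eq_empty_or_nonempty (F ∩ t) with h | h
      · exact Or.inl h
      · refine Or.inr ?_
        rcases hF with rfl | hF
        · simp at h
        · exact (M.isRelLowerSet_faces hF).2 Finset.inter_subset_left h
    rintro s ⟨hs, F, G, hF, hG, rfl⟩
    refine ⟨hs, fun t hts ht => ⟨ht, F ∩ t, G ∩ t, key K F t hF, key L G t hG, ?_⟩⟩
    rw [← Finset.union_inter_distrib_right]
    exact (Finset.inter_eq_right.mpr hts).symm

/-- The cone `{v} * K`. -/
def cone [DecidableEq V] (v : V) (K : PreAbstractSimplicialComplex V) :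
    PreAbstractSimplicialComplex V :=
  join (generate {{v}}) K

/-- The boundary of the octahedron `⟨x₁, y₁⟩ * ⟨x₂, y₂⟩ * ⟨x₃, y₃⟩`, in which the pairs of
opposite vertices are `xᵢ, yᵢ`. -/
def octahedron [DecidableEq V] (x₁ x₂ x₃ y₁ y₂ y₃ : V) : PreAbstractSimplicialComplex V :=
  join (join (generate {{x₁}, {y₁}}) (generate {{x₂}, {y₂}})) (generate {{x₃}, {y₃}})

/-- The vertices: the elements of `V` whose singleton is a face. -/
def vertexSet (K : PreAbstractSimplicialComplex V) : Set V := {v | {v} ∈ K}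

/-- The facets: the faces that are maximal with respect to inclusion. -/
def facets (K : PreAbstractSimplicialComplex V) : Set (Finset V) := {F | Maximal (· ∈ K) F}

/-- The boundary complex (of a pure complex): it is generated by the faces of codimension one that
lie in exactly one facet. -/
def boundary (K : PreAbstractSimplicialComplex V) : PreAbstractSimplicialComplex V :=
  generate {F | F ∈ K ∧ ∃! G, G ∈ K.facets ∧ F ⊆ G ∧ G.card = F.card + 1}

/-- A complex on `V` is flag if every non-face that does not properly contain another non-face has
cardinality two. (The empty set counts as a face.) -/
def IsFlag (K : PreAbstractSimplicialComplex V) : Prop :=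
  ∀ F : Finset V, F.Nonempty → F ∉ K → (∀ G, G ⊂ F → G.Nonempty → G ∈ K) → F.card = 2

/-- The geometric realization in barycentric coordinates, with the topology of `V → ℝ`. -/
def realization [Fintype V] (K : PreAbstractSimplicialComplex V) : Set (V → ℝ) :=
  {w | w ∈ stdSimplex ℝ V ∧ ∃ F ∈ K, ∀ v, v ∉ F → w v = 0}

/-- `K` is a simplicial `d`-sphere: its realization is homeomorphic to the unit sphere of
`ℝ^(d+1)`. -/
def IsSimplicialSphere [Fintype V] (K : PreAbstractSimplicialComplex V) (d : ℕ) : Prop :=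
  Nonempty (K.realization ≃ₜ Metric.sphere (0 : EuclideanSpace ℝ (Fin (d + 1))) 1)

/-- `K` triangulates the solid torus `D² × S¹`. -/
def IsTriangulatedSolidTorus [Fintype V] (K : PreAbstractSimplicialComplex V) : Prop :=
  Nonempty (K.realization ≃ₜ
    Metric.closedBall (0 : EuclideanSpace ℝ (Fin 2)) 1 ×
      Metric.sphere (0 : EuclideanSpace ℝ (Fin 2)) 1)

end PreAbstractSimplicialComplex

namespace FlagThreeSphere

open PreAbstractSimplicialComplex

/-- The twelve vertices. -/
inductive Vertex
  | v1 | v2 | v3 | x1 | x2 | x3 | y1 | y2 | y3 | z1 | z2 | z3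
  deriving DecidableEq

instance : Fintype Vertex where
  elems := {.v1, .v2, .v3, .x1, .x2, .x3, .y1, .y2, .y3, .z1, .z2, .z3}
  complete := by intro v; cases v <;> decide

/-- The nine vertices of the product of the triangle `abc` and the 3-cycle `123`. -/
inductive PrismVertex
  | a1 | a2 | a3 | b1 | b2 | b3 | c1 | c2 | c3
  deriving DecidableEq

section
open Vertex

/-- The first solid torus: a cyclic chain of three cones over octahedra. -/
def Gamma1 : PreAbstractSimplicialComplex Vertex :=
  cone v1 (octahedron x1 x2 x3 y1 y2 y3) ⊔
  cone v2 (octahedron y1 y2 y3 z1 z2 z3) ⊔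
  cone v3 (octahedron x1 x2 x3 z3 z1 z2)

end

section
open PrismVertex

/-- The staircase triangulation of the product of the triangle `abc` and the 3-cycle `123`, for
the orders `a < b < c` and `1 < 2`, `2 < 3`, `3 < 1`. -/
def staircaseFacets : Set (Finset PrismVertex) :=
  {{a1, b1, c1, c2}, {a1, b1, b2, c2}, {a1, a2, b2, c2},
   {a2, b2, c2, c3}, {a2, b2, b3, c3}, {a2, a3, b3, c3},
   {a3, b3, c3, c1}, {a3, b3, b1, c1}, {a3, a1, b1, c1}}

end

/-- The identification of the vertices of the product with the vertices `xᵢ, yᵢ, zᵢ`. -/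
def phi : PrismVertex → Vertex
  | .a1 => .z2 | .a2 => .z3 | .a3 => .z1
  | .b1 => .y3 | .b2 => .y1 | .b3 => .y2
  | .c1 => .x1 | .c2 => .x2 | .c3 => .x3

/-- The second solid torus. -/
def Gamma2 : PreAbstractSimplicialComplex Vertex :=
  generate ((fun F => F.image phi) '' staircaseFacets)

/-- The complex `Δ_{12,33}`. -/
def Delta : PreAbstractSimplicialComplex Vertex := Gamma1 ⊔ Gamma2

end FlagThreeSphere

/-!
The realization of `Δ` is identified with the boundary of the 4-dimensional polytope `T × T`, where
`T` is a triangle, by a map that is linear on every simplex. Write the vertices `xᵢ, yᵢ, zᵢ` as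
`aᵢ, bᵢ, cᵢ` by means of `φ`. Then `aᵢ` is sent to the vertex `(a, i)` of the product of the
triangles `abc` and `123`, and the apexes `v₁, v₂, v₃` are sent to the barycentres of the prisms
`bc × 123`, `ab × 123`, `ac × 123`.

The boundary of `T × T` is the union of the two solid tori `∂T × T` and `T × ∂T`. The second one is
cut by the staircase triangulations of the three prisms `abc × {i, i + 1}`, which is the image of
`Γ₂`. The three prisms that make up the first one have boundaries triangulated as octahedra: their
lateral squares are cut in the same way as in the staircase triangulation. Each of these prisms is
the cone over its boundary from its barycentre, and this is the image of `Γ₁`.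

That the map is a bijection onto these sets comes down to solving the equations for the weights of a
point of a prism. Instead of the list of facets, one uses that the supports of the points of a cone
over an octahedron are described by the vanishing of a product of weights for each antipodal pair
(`mem_realization_Gamma1`), and similarly for the staircase (`mem_realization_Gamma2`). Existence
and uniqueness of the weights are `exists_antiprism`, `antiprism_unique`, `exists_staircase`
and `staircase_unique`. Being continuous on a compact set, the bijection is a homeomorphism
(`bijOn_Gamma1`, `bijOn_Gamma2`, `bijOn_Delta`), and convex bodies are homeomorphic to balls.

The remaining assertions are finite computations on the lists of facets. Flagness is reduced to the
statement that each face can be enlarged by any vertex adjacent to all of its vertices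
(`isFlag_ofLists`).
-/

/-! ### Complexes generated by lists of facets -/

namespace PreAbstractSimplicialComplex

variable {V : Type*}

theorem mem_generate {S : Set (Finset V)} {s : Finset V} :
    s ∈ generate S ↔ s.Nonempty ∧ ∃ F ∈ S, s ⊆ F := Iff.rfl

theorem mem_sup {K L : PreAbstractSimplicialComplex V} {s : Finset V} :
    s ∈ K ⊔ L ↔ s ∈ K ∨ s ∈ L := Iff.rfl

theorem mem_inf {K L : PreAbstractSimplicialComplex V} {s : Finset V} :
    s ∈ K ⊓ L ↔ s ∈ K ∧ s ∈ L := Iff.rfl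

theorem generate_union (S T : Set (Finset V)) :
    generate (S ∪ T) = generate S ⊔ generate T := by
  refine SetLike.ext fun s => ?_
  simp only [mem_generate, mem_sup, Set.mem_union]
  grind

theorem join_generate [DecidableEq V] {S T : Set (Finset V)} (hS : S.Nonempty)
    (hT : T.Nonempty) :
    join (generate S) (generate T) = generate (Set.image2 (· ∪ ·) S T) := by
  refine SetLike.ext fun s => and_congr_right fun _ => ?_
  constructor
  · rintro ⟨F, G, hF, hG, rfl⟩
    have key : ∀ {R : Set (Finset V)} (_ : R.Nonempty) {F : Finset V},
        (F = ∅ ∨ F ∈ generate R) → ∃ A ∈ R, F ⊆ A := by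
      rintro R ⟨A, hA⟩ F (rfl | hF)
      · exact ⟨A, hA, Finset.empty_subset A⟩
      · exact hF.2
    obtain ⟨A, hA, hFA⟩ := key hS hF
    obtain ⟨B, hB, hGB⟩ := key hT hG
    exact ⟨A ∪ B, Set.mem_image2_of_mem hA hB, Finset.union_subset_union hFA hGB⟩
  · rintro ⟨_, ⟨A, hA, B, hB, rfl⟩, hs⟩
    have key : ∀ {R : Set (Finset V)} {A : Finset V} (_ : A ∈ R),
        s ∩ A = ∅ ∨ s ∩ A ∈ generate R := fun {R A} hA =>
      (Finset.eq_empty_or_nonempty (s ∩ A)).imp_right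
        fun h => ⟨h, A, hA, Finset.inter_subset_right⟩
    exact ⟨s ∩ A, s ∩ B, key hA, key hB, by
      rw [← Finset.inter_union_distrib_left, Finset.inter_eq_left.mpr hs]⟩

/-- The complex generated by the vertex sets of the members of a list of lists. Lists, unlike
finite sets of finite sets, are evaluated efficiently by the kernel. -/
def ofLists [DecidableEq V] (L : List (List V)) : PreAbstractSimplicialComplex V :=
  generate (List.toFinset '' {l | l ∈ L})

section ofLists

variable [DecidableEq V] {L M R : List (List V)} {n : ℕ}

theorem mem_ofLists {s : Finset V} :
    s ∈ ofLists L ↔ s.Nonempty ∧ ∃ l ∈ L, ∀ v ∈ s, v ∈ l := by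
  refine and_congr_right fun _ => ?_
  simp [Finset.subset_iff]

theorem ofLists_append (L M : List (List V)) : ofLists (L ++ M) = ofLists L ⊔ ofLists M := by
  rw [ofLists, ofLists, ofLists, ← generate_union, ← Set.image_union]
  congr 2
  ext l
  simp

theorem cone_octahedron_eq_ofLists (v x₁ x₂ x₃ y₁ y₂ y₃ : V) :
    cone v (octahedron x₁ x₂ x₃ y₁ y₂ y₃) =
      ofLists [[v, x₁, x₂, x₃], [v, x₁, x₂, y₃], [v, x₁, y₂, x₃], [v, x₁, y₂, y₃],
        [v, y₁, x₂, x₃], [v, y₁, x₂, y₃], [v, y₁, y₂, x₃], [v, y₁, y₂, y₃]] := by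
  rw [cone, octahedron, join_generate (by simp) (by simp),
    join_generate ((by simp : Set.Nonempty _).image2 (by simp)) (by simp),
    join_generate (by simp)
      (((by simp : Set.Nonempty _).image2 (by simp)).image2 (by simp)), ofLists]
  congr 1
  ext F
  simp only [Set.image2_singleton_left,
    Set.image2_insert_right, Set.image2_singleton_right, Set.image_insert_eq, Set.image_singleton,
    Set.mem_union, Set.mem_insert_iff, Set.mem_singleton_iff, ← Finset.insert_eq,
    Finset.insert_union, Set.image_union, Set.mem_image, Set.mem_ofPred_eq, List.mem_cons,
    List.not_mem_nil, or_false, or_and_right, exists_or, exists_eq_left, List.toFinset_cons,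
    List.toFinset_nil, insert_empty_eq, @eq_comm _ _ F]
  tauto

/-- A family of sets of equal size is the set of facets of the complex it generates. -/
theorem facets_ofLists (hL : ∀ l ∈ L, l.Nodup ∧ l.length = n + 1) :
    (ofLists L).facets = List.toFinset '' {l | l ∈ L} := by
  have hcard : ∀ l ∈ L, l.toFinset.card = n + 1 := fun l hl => by
    rw [List.toFinset_card_of_nodup (hL l hl).1, (hL l hl).2]
  ext F
  constructor
  · rintro ⟨⟨hF, _, ⟨l, hl, rfl⟩, hFl⟩, hmax⟩
    exact ⟨l, hl, Finset.Subset.antisymm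
      (hmax ⟨hF.mono hFl, _, ⟨l, hl, rfl⟩, subset_rfl⟩ hFl) hFl⟩
  · rintro ⟨l, hl, rfl⟩
    refine ⟨⟨?_, _, ⟨l, hl, rfl⟩, subset_rfl⟩, ?_⟩
    · rw [← Finset.card_pos, hcard l hl]; omega
    · rintro G ⟨-, _, ⟨m, hm, rfl⟩, hGm⟩ hlG
      have h : l.toFinset = m.toFinset :=
        Finset.eq_of_subset_of_card_le (hlG.trans hGm) (by rw [hcard l hl, hcard m hm])
      exact h ▸ hGm

theorem ncard_facets_ofLists (hL : ∀ l ∈ L, l.Nodup ∧ l.length = n + 1)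
    (hne : L.Pairwise fun l m => ¬ l ⊆ m) : (ofLists L).facets.ncard = L.length := by
  have h : List.toFinset '' {l | l ∈ L} = ((L.map List.toFinset).toFinset : Set (Finset V)) := by
    ext F; simp
  rw [facets_ofLists hL, h, Set.ncard_coe_finset, List.toFinset_card_of_nodup, List.length_map]
  refine List.Pairwise.map _ (fun l m hlm heq => hlm fun v hv => ?_) hne
  rwa [← List.mem_toFinset, ← heq, List.mem_toFinset]

/-- If each codimension-one face of each member of `L` either lies in a second member of `L` or is
listed in `R`, and the members of `R` lie in exactly one member of `L`, then `R` generates the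
boundary. -/
theorem boundary_ofLists (hn : 0 < n) (hL : ∀ l ∈ L, l.Nodup ∧ l.length = n + 1)
    (hridge : ∀ l ∈ L, ∀ v ∈ l,
      (∃ m ∈ L, ¬ l ⊆ m ∧ l.erase v ⊆ m) ∨ ∃ r ∈ R, l.erase v ⊆ r)
    (hR : ∀ r ∈ R, r.Nodup ∧ r.length = n ∧ (L.filter (r ⊆ ·)).length = 1) :
    (ofLists L).boundary = ofLists R := by
  have hcard : ∀ l ∈ L, l.toFinset.card = n + 1 := fun l hl => by
    rw [List.toFinset_card_of_nodup (hL l hl).1, (hL l hl).2]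
  have hcardR : ∀ r ∈ R, r.toFinset.card = n := fun r hr => by
    rw [List.toFinset_card_of_nodup (hR r hr).1, (hR r hr).2.1]
  refine SetLike.ext fun s => and_congr_right fun _ => ?_
  rw [facets_ofLists hL]
  constructor
  · rintro ⟨F, ⟨-, _, ⟨⟨l, hl, rfl⟩, hFl, hFcard⟩, huniq⟩, hsF⟩
    obtain ⟨v, hv⟩ : ∃ v, l.toFinset \ F = {v} := by
      rw [← Finset.card_eq_one, Finset.card_sdiff_of_subset hFl]; omega
    have hvl : v ∈ l ∧ v ∉ F := by
      rw [← List.mem_toFinset, ← Finset.mem_sdiff, hv, Finset.mem_singleton]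
    have hFe : ∀ u ∈ F, u ∈ l.erase v := fun u hu =>
      (List.mem_erase_of_ne fun h : u = v => hvl.2 (h ▸ hu)).2 (List.mem_toFinset.1 (hFl hu))
    rcases hridge l hl v hvl.1 with ⟨m, hm, hlm, hem⟩ | ⟨r, hr, her⟩
    · have h := huniq m.toFinset ⟨⟨m, hm, rfl⟩, fun u hu => List.mem_toFinset.2 (hem (hFe u hu)),
        by rw [hcard m hm, ← hFcard, hcard l hl]⟩
      exact (hlm fun u hu => by rwa [← List.mem_toFinset, h, List.mem_toFinset]).elim
    · exact ⟨_, ⟨r, hr, rfl⟩, fun u hu => List.mem_toFinset.2 (her (hFe u (hsF hu)))⟩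
  · rintro ⟨_, ⟨r, hr, rfl⟩, hsr⟩
    obtain ⟨l, hl⟩ := List.length_eq_one_iff.1 (hR r hr).2.2
    have hmem : ∀ m, m ∈ L ∧ r ⊆ m ↔ m = l := fun m => by
      rw [← List.mem_singleton, ← hl]; simp
    have hsub : ∀ m : List V, r.toFinset ⊆ m.toFinset ↔ r ⊆ m := fun m => by
      simp [Finset.subset_iff, List.subset_def]
    obtain ⟨hlL, hrl⟩ := (hmem l).2 rfl
    refine ⟨r.toFinset, ⟨⟨?_, _, ⟨l, hlL, rfl⟩, (hsub l).2 hrl⟩, l.toFinset,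
      ⟨⟨l, hlL, rfl⟩, (hsub l).2 hrl, by rw [hcard l hlL, hcardR r hr]⟩, ?_⟩, hsr⟩
    · rw [← Finset.card_pos, hcardR r hr]; exact hn
    · rintro _ ⟨⟨m, hm, rfl⟩, hrm, -⟩
      rw [(hmem m).1 ⟨hm, (hsub m).1 hrm⟩]

theorem ofLists_inf_ofLists
    (hLM : ∀ l ∈ L, ∀ m ∈ M, (∃ v ∈ l, v ∈ m) → ∃ r ∈ R, ∀ v ∈ l, v ∈ m → v ∈ r)
    (hR : ∀ r ∈ R, (∃ l ∈ L, r ⊆ l) ∧ ∃ m ∈ M, r ⊆ m) :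
    ofLists L ⊓ ofLists M = ofLists R := by
  refine SetLike.ext fun s => ?_
  rw [mem_inf, mem_ofLists, mem_ofLists, mem_ofLists]
  constructor
  · rintro ⟨⟨⟨u, hu⟩, l, hl, hsl⟩, -, m, hm, hsm⟩
    obtain ⟨r, hr, hlmr⟩ := hLM l hl m hm ⟨u, hsl u hu, hsm u hu⟩
    exact ⟨⟨u, hu⟩, r, hr, fun v hv => hlmr v (hsl v hv) (hsm v hv)⟩
  · rintro ⟨hs, r, hr, hsr⟩
    obtain ⟨⟨l, hl, hrl⟩, m, hm, hrm⟩ := hR r hr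
    exact ⟨⟨hs, l, hl, fun v hv => hrl (hsr v hv)⟩, hs, m, hm, fun v hv => hrm (hsr v hv)⟩

/-- A criterion for flagness: every vertex is present, and a face can be enlarged by each vertex
joined to all of its vertices. Every clique is then built up to a face one vertex at a time. -/
theorem isFlag_ofLists (hvert : ∀ v, ∃ l ∈ L, v ∈ l)
    (hL : ∀ l ∈ L, ∀ g ∈ l.sublists, ∀ v, (∀ u ∈ g, ∃ m ∈ L, u ∈ m ∧ v ∈ m) →
      ∃ m ∈ L, v ∈ m ∧ ∀ u ∈ g, u ∈ m) :
    (ofLists L).IsFlag := by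
  have clique : ∀ F : Finset V, F.Nonempty → (∀ u ∈ F, ∀ v ∈ F, ∃ m ∈ L, u ∈ m ∧ v ∈ m) →
      ∃ m ∈ L, ∀ v ∈ F, v ∈ m := by
    intro F hF
    induction hF using Finset.Nonempty.cons_induction with
    | singleton v => simp [hvert v]
    | cons v F hv hF ih =>
      intro h
      obtain ⟨l, hl, hFl⟩ := ih fun u hu w hw =>
        h u (Finset.mem_cons_of_mem hu) w (Finset.mem_cons_of_mem hw)
      have hmem : ∀ u, u ∈ l.filter (· ∈ F) ↔ u ∈ F := fun u => by
        simpa using hFl u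
      obtain ⟨m, hm, hvm, hFm⟩ := hL l hl (l.filter (· ∈ F))
        (List.mem_sublists.2 List.filter_sublist) v fun u hu =>
          h u (Finset.mem_cons_of_mem ((hmem u).1 hu)) v (Finset.mem_cons_self v F)
      refine ⟨m, hm, fun u hu => ?_⟩
      rcases Finset.mem_cons.1 hu with rfl | hu
      · exact hvm
      · exact hFm u ((hmem u).2 hu)
  intro F hF hFK hsub
  by_contra hcard
  refine hFK (mem_ofLists.2 ⟨hF, clique F hF fun u hu v hv => ?_⟩)
  rcases eq_or_ne u v with rfl | hne
  · simpa using hvert u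
  · have huv : ({u, v} : Finset V) ⊆ F := by
      simp [Finset.insert_subset_iff, hu, hv]
    have h := hsub {u, v} (huv.ssubset_of_ne fun h => hcard ?_) (by simp)
    · simpa using (mem_ofLists.1 h).2
    · rw [← h, Finset.card_pair hne]

end ofLists

end PreAbstractSimplicialComplex

/-! ### The facets of the two solid tori -/

namespace FlagThreeSphere

open PreAbstractSimplicialComplex

section
open Vertex

/-- The 24 facets of `Γ₁`. -/
def gamma1Facets : List (List Vertex) :=
  [[v1, x1, x2, x3], [v1, x1, x2, y3], [v1, x1, y2, x3], [v1, x1, y2, y3],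
   [v1, y1, x2, x3], [v1, y1, x2, y3], [v1, y1, y2, x3], [v1, y1, y2, y3],
   [v2, y1, y2, y3], [v2, y1, y2, z3], [v2, y1, z2, y3], [v2, y1, z2, z3],
   [v2, z1, y2, y3], [v2, z1, y2, z3], [v2, z1, z2, y3], [v2, z1, z2, z3],
   [v3, x1, x2, x3], [v3, x1, x2, z2], [v3, x1, z1, x3], [v3, x1, z1, z2],
   [v3, z3, x2, x3], [v3, z3, x2, z2], [v3, z3, z1, x3], [v3, z3, z1, z2]]

/-- The nine facets of `Γ₂`. -/
def gamma2Facets : List (List Vertex) :=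
  [[z2, y3, x1, x2], [z2, y3, y1, x2], [z2, z3, y1, x2],
   [z3, y1, x2, x3], [z3, y1, y2, x3], [z3, z1, y2, x3],
   [z1, y2, x3, x1], [z1, y2, y3, x1], [z1, z2, y3, x1]]

/-- The 18 triangles of the common boundary torus of `Γ₁` and `Γ₂`. -/
def torusTriangles : List (List Vertex) :=
  [[x1, x2, y3], [x1, y2, x3], [x1, y2, y3], [y1, x2, x3], [y1, x2, y3], [y1, y2, x3],
   [y1, y2, z3], [y1, z2, y3], [y1, z2, z3], [z1, y2, y3], [z1, y2, z3], [z1, z2, y3],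
   [x1, x2, z2], [x1, z1, x3], [x1, z1, z2], [z3, x2, x3], [z3, x2, z2], [z3, z1, x3]]

end

theorem Gamma1_eq_ofLists : Gamma1 = ofLists gamma1Facets := by
  rw [Gamma1, cone_octahedron_eq_ofLists, cone_octahedron_eq_ofLists, cone_octahedron_eq_ofLists,
    ← ofLists_append, ← ofLists_append]
  rfl

theorem Gamma2_eq_ofLists : Gamma2 = ofLists gamma2Facets := by
  rw [Gamma2, ofLists]
  congr 1
  ext F
  simp [gamma2Facets, staircaseFacets, Set.image_insert_eq, phi, @eq_comm _ F]

theorem Delta_eq_ofLists : Delta = ofLists (gamma1Facets ++ gamma2Facets) := by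
  rw [Delta, Gamma1_eq_ofLists, Gamma2_eq_ofLists, ofLists_append]

theorem Gamma1_boundary : Gamma1.boundary = ofLists torusTriangles := by
  rw [Gamma1_eq_ofLists]
  exact boundary_ofLists (n := 3) (by decide) (by decide +kernel) (by decide +kernel)
    (by decide +kernel)

theorem Gamma2_boundary : Gamma2.boundary = ofLists torusTriangles := by
  rw [Gamma2_eq_ofLists]
  exact boundary_ofLists (n := 3) (by decide) (by decide +kernel) (by decide +kernel)
    (by decide +kernel)

theorem Gamma1_inf_Gamma2 : Gamma1 ⊓ Gamma2 = ofLists torusTriangles := by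
  rw [Gamma1_eq_ofLists, Gamma2_eq_ofLists]
  exact ofLists_inf_ofLists (by decide +kernel) (by decide +kernel)

theorem Delta_isFlag : Delta.IsFlag := by
  rw [Delta_eq_ofLists]
  exact isFlag_ofLists (by decide +kernel) (by decide +kernel)

theorem ncard_Delta_vertexSet : Delta.vertexSet.ncard = 12 := by
  have h : Delta.vertexSet = Set.univ := by
    have hvert : ∀ v, ∃ l ∈ gamma1Facets ++ gamma2Facets, v ∈ l := by decide +kernel
    rw [Delta_eq_ofLists, Set.eq_univ_iff_forall]
    exact fun v => mem_ofLists.2 ⟨Finset.singleton_nonempty v, by simpa using hvert v⟩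
  rw [h, Set.ncard_univ, Nat.card_eq_fintype_card]
  rfl

theorem ncard_Delta_facets : Delta.facets.ncard = 33 := by
  rw [Delta_eq_ofLists]
  exact ncard_facets_ofLists (n := 3) (by decide +kernel) (by decide +kernel)

end FlagThreeSphere

/-! ### Compact convex bodies and realizations -/

theorem Set.BijOn.nonempty_homeomorph_of_isCompact {X Y : Type*} [TopologicalSpace X]
    [TopologicalSpace Y] [T2Space Y] {f : X → Y} {K : Set X} {S : Set Y} (h : Set.BijOn f K S)
    (hf : Continuous f) (hK : IsCompact K) : Nonempty (K ≃ₜ S) := by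
  have := isCompact_iff_compactSpace.1 hK
  exact ⟨Continuous.homeoOfEquivCompactToT2 (f := Set.BijOn.equiv f h)
    ((hf.comp continuous_subtype_val).subtype_mk _)⟩

/-- In a space of the same dimension as the Euclidean space `ℝⁿ`, a compact convex body is
homeomorphic to the unit ball of `ℝⁿ`, by a homeomorphism that takes its frontier to the unit
sphere. -/
theorem Convex.nonempty_homeomorph_closedBall_sphere {E : Type*} [NormedAddCommGroup E]
    [NormedSpace ℝ E] [FiniteDimensional ℝ E] {n : ℕ} (hn : Module.finrank ℝ E = n) {s : Set E}
    (hc : Convex ℝ s) (hs : IsCompact s) (hne : (interior s).Nonempty) :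
    Nonempty (s ≃ₜ Metric.closedBall (0 : EuclideanSpace ℝ (Fin n)) 1) ∧
      Nonempty (frontier s ≃ₜ Metric.sphere (0 : EuclideanSpace ℝ (Fin n)) 1) := by
  let e : E ≃L[ℝ] EuclideanSpace ℝ (Fin n) := ContinuousLinearEquiv.ofFinrankEq (by simpa using hn)
  have hint : interior (e '' s) = e '' interior s := (e.toHomeomorph.image_interior s).symm
  have hfr : frontier (e '' s) = e '' frontier s := (e.toHomeomorph.image_frontier s).symm
  have hcomp : IsCompact (e '' s) := hs.image e.continuous
  obtain ⟨h, -, h₁, h₂⟩ := exists_homeomorph_image_interior_closure_frontier_eq_unitBall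
    (s := e '' s) (hc.linear_image (e : E →ₗ[ℝ] EuclideanSpace ℝ (Fin n)))
    (hint ▸ hne.image e) hcomp.isBounded
  rw [hcomp.isClosed.closure_eq] at h₁
  rw [hfr] at h₂
  exact ⟨⟨((e.toHomeomorph.image s).trans (h.image _)).trans (Homeomorph.setCongr h₁)⟩,
    ⟨((e.toHomeomorph.image (frontier s)).trans (h.image _)).trans (Homeomorph.setCongr h₂)⟩⟩

namespace PreAbstractSimplicialComplex

variable {V : Type*} [Fintype V]

theorem isCompact_realization (K : PreAbstractSimplicialComplex V) : IsCompact K.realization := by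
  have h : K.realization =
      stdSimplex ℝ V ∩ ⋃ F ∈ (K : Set (Finset V)), {w | ∀ v, v ∉ F → w v = 0} := by
    ext w
    simp [realization]
  rw [h]
  refine (isCompact_stdSimplex ℝ V).inter_right ((Set.toFinite _).isClosed_biUnion fun F _ => ?_)
  simp only [Set.ofPred_forall]
  exact isClosed_iInter fun v => isClosed_iInter fun _ =>
    isClosed_eq (continuous_apply v) continuous_const

theorem realization_sup (K L : PreAbstractSimplicialComplex V) :
    (K ⊔ L).realization = K.realization ∪ L.realization := by
  ext w
  simp only [realization, mem_sup, Set.mem_union, Set.mem_ofPred_eq]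
  grind

theorem mem_realization_ofLists [DecidableEq V] {L : List (List V)} {w : V → ℝ} :
    w ∈ (ofLists L).realization ↔ w ∈ stdSimplex ℝ V ∧ ∃ l ∈ L, ∀ v, v ∉ l → w v = 0 := by
  refine and_congr_right fun hw => ?_
  constructor
  · rintro ⟨F, hF, hw⟩
    obtain ⟨-, l, hl, hFl⟩ := mem_ofLists.1 hF
    exact ⟨l, hl, fun v hv => hw v fun h => hv (hFl v h)⟩
  · rintro ⟨l, hl, hwl⟩
    refine ⟨l.toFinset, mem_ofLists.2 ⟨?_, l, hl, by simp⟩, by simpa using hwl⟩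
    -- the coordinates sum to `1`, so some coordinate is nonzero
    obtain ⟨v, -, hv⟩ := Finset.exists_ne_zero_of_sum_ne_zero (hw.2.trans_ne one_ne_zero)
    exact ⟨v, List.mem_toFinset.2 (by_contra fun h => hv (hwl v h))⟩

end PreAbstractSimplicialComplex

/-! ### The triangle -/

/-- The closed set cut out by finitely many affine inequalities has as frontier the points at
which one of them is an equality, provided all of them can be strict at once: from a point of
equality, moving away from the strict point leaves the set. -/
theorem frontier_setOf_forall_nonneg {E ι : Type*} [NormedAddCommGroup E] [NormedSpace ℝ E]
    [Finite ι] (l : ι → E →L[ℝ] ℝ) (c : ι → ℝ) {x₀ : E} (hx₀ : ∀ i, 0 < l i x₀ + c i) :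
    frontier {x | ∀ i, 0 ≤ l i x + c i} = {x | (∀ i, 0 ≤ l i x + c i) ∧ ∃ i, l i x + c i = 0} := by
  have hclosed : IsClosed {x | ∀ i, 0 ≤ l i x + c i} := by
    simp only [Set.ofPred_forall]
    exact isClosed_iInter fun i => isClosed_le continuous_const (by fun_prop)
  have hopen : IsOpen {x | ∀ i, 0 < l i x + c i} := by
    simp only [Set.ofPred_forall]
    exact isOpen_iInter_of_finite fun i => isOpen_lt continuous_const (by fun_prop)
  rw [hclosed.frontier_eq]
  ext x
  refine and_congr_right fun hx => ⟨fun h => ?_, ?_⟩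
  · by_contra! hne
    exact h (interior_maximal (fun y hy i => (hy i).le) hopen fun i => (hx i).lt_of_ne' (hne i))
  · rintro ⟨i, hi⟩ hint
    have hcont : Continuous fun t : ℝ => x + t • (x - x₀) := by fun_prop
    have hev : ∀ᶠ t in nhds (0 : ℝ), x + t • (x - x₀) ∈ {x | ∀ i, 0 ≤ l i x + c i} :=
      hcont.tendsto' 0 x (by simp) (mem_interior_iff_mem_nhds.1 hint)
    obtain ⟨t, ht, ht₀⟩ := ((hev.filter_mono nhdsWithin_le_nhds).and
      (self_mem_nhdsWithin (a := (0 : ℝ)) (s := Set.Ioi 0))).exists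
    have h := ht i
    simp only [map_add, map_smul, map_sub, smul_eq_mul] at h
    have h₂ := mul_pos ht₀ (hx₀ i)
    nlinarith

namespace FlagThreeSphere

/-- The plane triangle with vertices `(0, 0)`, `(1, 0)`, `(0, 1)`. Its points have barycentric
coordinates `1 - p 0 - p 1`, `p 0`, `p 1`. -/
def triangle : Set (EuclideanSpace ℝ (Fin 2)) := {p | 0 ≤ p 0 ∧ 0 ≤ p 1 ∧ p 0 + p 1 ≤ 1}

theorem convex_triangle : Convex ℝ triangle := by
  rintro p ⟨hp₀, hp₁, hp₂⟩ q ⟨hq₀, hq₁, hq₂⟩ a b ha hb hab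
  refine ⟨?_, ?_, ?_⟩ <;> simp only [PiLp.add_apply, PiLp.smul_apply, smul_eq_mul]
  · positivity
  · positivity
  · nlinarith [mul_le_mul_of_nonneg_left hp₂ ha, mul_le_mul_of_nonneg_left hq₂ hb]

theorem triangle_eq : triangle = {x | ∀ i, 0 ≤
    (![EuclideanSpace.proj 0, EuclideanSpace.proj 1, -(EuclideanSpace.proj 0 +
      EuclideanSpace.proj 1)] : Fin 3 → EuclideanSpace ℝ (Fin 2) →L[ℝ] ℝ) i x +
      (![0, 0, 1] : Fin 3 → ℝ) i} := by
  ext p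
  simp only [triangle, Set.mem_ofPred_eq, Fin.forall_fin_succ, Fin.isValue]
  simp
  grind

theorem frontier_triangle :
    frontier triangle = {p | p ∈ triangle ∧ (p 0 = 0 ∨ p 1 = 0 ∨ p 0 + p 1 = 1)} := by
  rw [triangle_eq, frontier_setOf_forall_nonneg _ _ (x₀ := !₂[1 / 3, 1 / 3])]
  · ext p
    simp only [Set.mem_ofPred_eq, Fin.exists_fin_succ]
    simp
    grind
  · intro i
    fin_cases i <;> norm_num

theorem isCompact_triangle : IsCompact triangle := by
  refine Metric.isCompact_of_isClosed_isBounded ?_ ?_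
  · have h : triangle = {p | 0 ≤ p 0} ∩ ({p | 0 ≤ p 1} ∩ {p | p 0 + p 1 ≤ 1}) := rfl
    rw [h]
    exact (isClosed_le (by fun_prop) (by fun_prop)).inter
      ((isClosed_le (by fun_prop) (by fun_prop)).inter (isClosed_le (by fun_prop) (by fun_prop)))
  · refine (Metric.isBounded_closedBall (x := (0 : EuclideanSpace ℝ (Fin 2))) (r := 1)).subset ?_
    rintro p ⟨h₀, h₁, h₂⟩
    rw [mem_closedBall_zero_iff, EuclideanSpace.norm_eq]
    refine Real.sqrt_le_one.2 ?_
    simp only [Fin.sum_univ_two, Real.norm_eq_abs, sq_abs]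
    nlinarith

theorem interior_triangle_nonempty : (interior triangle).Nonempty := by
  have h : !₂[(1 / 3 : ℝ), 1 / 3] ∈ triangle := by
    refine ⟨?_, ?_, ?_⟩ <;> norm_num
  by_contra hne
  have hfr : !₂[(1 / 3 : ℝ), 1 / 3] ∈ frontier triangle :=
    ⟨subset_closure h, fun hint => hne ⟨_, hint⟩⟩
  rw [frontier_triangle] at hfr
  obtain ⟨-, h | h | h⟩ := hfr <;> norm_num at h

end FlagThreeSphere

/-! ### Coordinates in triangulated prisms -/

namespace FlagThreeSphere

/-- Once the weight of the apex is known, the weights `p` are determined: if one of them were larger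
than in a second system, the vanishing products would make the two others at least as large, against
the equality of the sums. -/
theorem le_of_antiprism {p q p' q' : Fin 3 → ℝ}
    (hp : ∀ i, 0 ≤ p i) (hq : ∀ i, 0 ≤ q i) (hp' : ∀ i, 0 ≤ p' i) (hq' : ∀ i, 0 ≤ q' i)
    (h : ∀ i, p i * q (i + 1) = 0) (h' : ∀ i, p' i * q' (i + 1) = 0)
    (hP : ∑ i, p i = ∑ i, p' i) (hlevel : ∀ i, p i + q i = p' i + q' i) (i : Fin 3) :
    p i ≤ p' i := by
  have hsum : ∀ f : Fin 3 → ℝ, ∑ j, f j = f i + f (i + 1) + f (i + 2) := fun f => by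
    rw [Fin.sum_univ_three]
    fin_cases i <;> simp <;> ring
  by_contra! hlt
  have h₁ : q (i + 1) = 0 := (mul_eq_zero.1 (h i)).resolve_left ((hp' i).trans_lt hlt).ne'
  have h₂ : p' (i + 2) = 0 := by
    refine (mul_eq_zero.1 (h' (i + 2))).resolve_right ?_
    have hi : i + 2 + 1 = i := by fin_cases i <;> rfl
    rw [hi]
    exact (by linarith [hlevel i, hq i] : 0 < q' i).ne'
  linarith [hsum p, hsum p', hlevel i, hlevel (i + 1), hp (i + 2), hq' (i + 1)]

/-- If the cone coordinate `m` were smaller than `m'`, each level and each of the two triangles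
would carry some weight of `p` and `q`, which the vanishing products forbid. -/
theorem le_apex_of_antiprism {p q p' q' : Fin 3 → ℝ} {m m' : ℝ}
    (hp' : ∀ i, 0 ≤ p' i) (hq' : ∀ i, 0 ≤ q' i) (h : ∀ i, p i * q (i + 1) = 0)
    (hP : ∑ i, p i + m / 2 = ∑ i, p' i + m' / 2) (hQ : ∑ i, q i + m / 2 = ∑ i, q' i + m' / 2)
    (hlevel : ∀ i, p i + q i + m / 3 = p' i + q' i + m' / 3) : m' ≤ m := by
  by_contra! hlt
  simp only [Fin.sum_univ_three] at hP hQ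
  have a₀ := hp' 0
  have a₁ := hp' 1
  have a₂ := hp' 2
  have b₀ := hq' 0
  have b₁ := hq' 1
  have b₂ := hq' 2
  have l₀ := hlevel 0
  have l₁ := hlevel 1
  have l₂ := hlevel 2
  have h₀ : p 0 * q 1 = 0 := h 0
  have h₁ : p 1 * q 2 = 0 := h 1
  have h₂ : p 2 * q 0 = 0 := h 2
  rcases mul_eq_zero.1 h₀ with h₀ | h₀ <;> rcases mul_eq_zero.1 h₁ with h₁ | h₁ <;>
    rcases mul_eq_zero.1 h₂ with h₂ | h₂ <;> linarith

/-- A point of the prism `segment × triangle` has at most one system of coordinates with respect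
to the triangulation of the prism as a cone over an octahedron: `p` and `q` are the weights of the
vertices of the two triangular ends, and `m` is the weight of the barycentre. -/
theorem antiprism_unique {p q p' q' : Fin 3 → ℝ} {m m' : ℝ}
    (hp : ∀ i, 0 ≤ p i) (hq : ∀ i, 0 ≤ q i) (hp' : ∀ i, 0 ≤ p' i) (hq' : ∀ i, 0 ≤ q' i)
    (h : ∀ i, p i * q (i + 1) = 0) (h' : ∀ i, p' i * q' (i + 1) = 0)
    (hP : ∑ i, p i + m / 2 = ∑ i, p' i + m' / 2) (hQ : ∑ i, q i + m / 2 = ∑ i, q' i + m' / 2)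
    (hlevel : ∀ i, p i + q i + m / 3 = p' i + q' i + m' / 3) :
    (∀ i, p i = p' i) ∧ (∀ i, q i = q' i) ∧ m = m' := by
  obtain rfl : m = m' := le_antisymm
    (le_apex_of_antiprism hp hq h' hP.symm hQ.symm fun i => (hlevel i).symm)
    (le_apex_of_antiprism hp' hq' h hP hQ hlevel)
  have hP' : ∑ i, p i = ∑ i, p' i := by linarith
  have hlevel' : ∀ i, p i + q i = p' i + q' i := fun i => by linarith [hlevel i]
  have hpp : ∀ i, p i = p' i := fun i => le_antisymm
    (le_of_antiprism hp hq hp' hq' h h' hP' hlevel' i)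
    (le_of_antiprism hp' hq' hp hq h' h hP'.symm (fun i => (hlevel' i).symm) i)
  exact ⟨hpp, fun i => by linarith [hpp i, hlevel' i], rfl⟩

/-- The points of the prism that lie in the cone over the lateral square of level `0`: there
the apex takes up all of the coordinate `β 0`. -/
theorem exists_antiprism_of_level_zero_le {P Q : ℝ} {β : Fin 3 → ℝ} (h₀ : 0 ≤ β 0)
    (hsum : P + Q = ∑ i, β i) (hP : 3 * β 0 ≤ 2 * P) (hQ : 3 * β 0 ≤ 2 * Q)
    (hβ : ∀ i, β 0 ≤ β i) :
    ∃ (p q : Fin 3 → ℝ) (m : ℝ), (∀ i, 0 ≤ p i) ∧ (∀ i, 0 ≤ q i) ∧ 0 ≤ m ∧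
      (∀ i, p i * q (i + 1) = 0) ∧ ∑ i, p i + m / 2 = P ∧ ∑ i, q i + m / 2 = Q ∧
      ∀ i, p i + q i + m / 3 = β i := by
  have h₁ := hβ 1
  have h₂ := hβ 2
  rw [Fin.sum_univ_three] at hsum
  rcases le_total (β 2 - β 0) (P - 3 * β 0 / 2) with h | h
  · refine ⟨![0, P - 3 * β 0 / 2 - (β 2 - β 0), β 2 - β 0], ![0, Q - 3 * β 0 / 2, 0], 3 * β 0,
      ?_, ?_, by linarith, ?_, ?_, ?_, ?_⟩ <;>
    simp [Fin.forall_fin_succ, Fin.sum_univ_three] <;> grind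
  · refine ⟨![0, 0, P - 3 * β 0 / 2], ![0, β 1 - β 0, β 2 - β 0 - (P - 3 * β 0 / 2)], 3 * β 0,
      ?_, ?_, by linarith, ?_, ?_, ?_, ?_⟩ <;>
    simp [Fin.forall_fin_succ, Fin.sum_univ_three] <;> grind

/-- Every point of the prism has coordinates with respect to the triangulation of the prism as a
cone over an octahedron. The weight `m` of the apex, which has the coordinates `1 / 2, 1 / 2` and
`1 / 3, 1 / 3, 1 / 3`, is the largest one that leaves nonnegative coordinates. -/
theorem exists_antiprism {P Q : ℝ} {β : Fin 3 → ℝ} (hP : 0 ≤ P) (hQ : 0 ≤ Q)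
    (hβ : ∀ i, 0 ≤ β i) (hsum : P + Q = ∑ i, β i) :
    ∃ (p q : Fin 3 → ℝ) (m : ℝ), (∀ i, 0 ≤ p i) ∧ (∀ i, 0 ≤ q i) ∧ 0 ≤ m ∧
      (∀ i, p i * q (i + 1) = 0) ∧ ∑ i, p i + m / 2 = P ∧ ∑ i, q i + m / 2 = Q ∧
      ∀ i, p i + q i + m / 3 = β i := by
  obtain ⟨i, hi⟩ := Finite.exists_min β
  -- the points in the cones over the two triangular ends
  by_cases hPi : 2 * P ≤ 3 * β i ∧ P ≤ Q
  · refine ⟨0, fun j => β j - 2 * P / 3, 2 * P, fun _ => le_rfl, fun j => ?_, by linarith,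
      fun j => zero_mul _, by simp, ?_, fun j => ?_⟩
    · linarith [hi j]
    · rw [Fin.sum_univ_three] at hsum ⊢
      linarith
    · simp only [Pi.zero_apply]
      ring
  by_cases hQi : 2 * Q ≤ 3 * β i ∧ Q ≤ P
  · refine ⟨fun j => β j - 2 * Q / 3, 0, 2 * Q, fun j => ?_, fun _ => le_rfl, by linarith,
      fun j => mul_zero _, ?_, by simp, fun j => ?_⟩
    · linarith [hi j]
    · rw [Fin.sum_univ_three] at hsum ⊢
      linarith
    · simp only [Pi.zero_apply]
      ring
  -- the remaining points, after a rotation that moves the smallest level to `0`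
  have hrot : ∀ f : Fin 3 → ℝ, ∑ j, f (j + i) = ∑ j, f j := Equiv.sum_comp (Equiv.addRight i)
  have hrot' : ∀ f : Fin 3 → ℝ, ∑ j, f (j - i) = ∑ j, f j := Equiv.sum_comp (Equiv.subRight i)
  obtain ⟨p, q, m, hp, hq, hm, hpq, hpP, hqQ, hlevel⟩ := exists_antiprism_of_level_zero_le
    (P := P) (Q := Q) (β := fun j => β (j + i)) (by simpa using hβ i) (by rw [hrot, hsum])
    (by rw [zero_add]; grind) (by rw [zero_add]; grind) (fun j => by simpa using hi (j + i))
  refine ⟨fun j => p (j - i), fun j => q (j - i), m, fun j => hp _, fun j => hq _, hm,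
    fun j => ?_, by rw [hrot', hpP], by rw [hrot', hqQ], fun j => ?_⟩
  · simpa only [add_sub_right_comm] using hpq (j - i)
  · simpa using hlevel (j - i)

/-- A point of the prism `triangle × segment` has at most one system of coordinates with respect
to the staircase triangulation. -/
theorem staircase_unique {a₀ a₁ b₀ b₁ c₀ c₁ a₀' a₁' b₀' b₁' c₀' c₁' : ℝ}
    (ha₁ : 0 ≤ a₁) (hb₀ : 0 ≤ b₀) (hb₁ : 0 ≤ b₁) (hc₀ : 0 ≤ c₀)
    (ha₁' : 0 ≤ a₁') (hb₀' : 0 ≤ b₀') (hb₁' : 0 ≤ b₁') (hc₀' : 0 ≤ c₀')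
    (hcb : c₀ * b₁ = 0) (hca : c₀ * a₁ = 0) (hba : b₀ * a₁ = 0)
    (hcb' : c₀' * b₁' = 0) (hca' : c₀' * a₁' = 0) (hba' : b₀' * a₁' = 0)
    (hA : a₀ + a₁ = a₀' + a₁') (hB : b₀ + b₁ = b₀' + b₁') (hC : c₀ + c₁ = c₀' + c₁')
    (hlevel : a₁ + b₁ + c₁ = a₁' + b₁' + c₁') :
    (a₀ = a₀' ∧ b₀ = b₀' ∧ c₀ = c₀') ∧ a₁ = a₁' ∧ b₁ = b₁' ∧ c₁ = c₁' := by
  have hc : c₁ = c₁' := by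
    rcases mul_eq_zero.1 hcb with h₁ | h₁ <;> rcases mul_eq_zero.1 hcb' with h₂ | h₂ <;>
    rcases mul_eq_zero.1 hca with h₃ | h₃ <;> rcases mul_eq_zero.1 hca' with h₄ | h₄ <;> linarith
  have ha : a₁ = a₁' := by
    rcases mul_eq_zero.1 hca with h₁ | h₁ <;> rcases mul_eq_zero.1 hca' with h₂ | h₂ <;>
    rcases mul_eq_zero.1 hba with h₃ | h₃ <;> rcases mul_eq_zero.1 hba' with h₄ | h₄ <;> linarith
  refine ⟨⟨?_, ?_, ?_⟩, ?_, ?_, ?_⟩ <;> linarith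

theorem exists_staircase {A B C t : ℝ} (hA : 0 ≤ A) (hB : 0 ≤ B) (hC : 0 ≤ C) (ht : 0 ≤ t)
    (ht' : t ≤ A + B + C) :
    ∃ a₀ a₁ b₀ b₁ c₀ c₁ : ℝ, (0 ≤ a₀ ∧ 0 ≤ a₁ ∧ 0 ≤ b₀ ∧ 0 ≤ b₁ ∧ 0 ≤ c₀ ∧ 0 ≤ c₁) ∧
      (c₀ * b₁ = 0 ∧ c₀ * a₁ = 0 ∧ b₀ * a₁ = 0) ∧
      a₀ + a₁ = A ∧ b₀ + b₁ = B ∧ c₀ + c₁ = C ∧ a₁ + b₁ + c₁ = t := by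
  rcases le_total t C with h₁ | h₁
  · exact ⟨A, 0, B, 0, C - t, t, by grind, by grind, by grind⟩
  rcases le_total t (B + C) with h₂ | h₂
  · exact ⟨A, 0, B + C - t, t - C, 0, C, by grind, by grind, by grind⟩
  · exact ⟨A + B + C - t, t - B - C, 0, B, 0, C, by grind, by grind, by grind⟩

end FlagThreeSphere

/-! ### Supports of the points of the two solid tori -/

namespace PreAbstractSimplicialComplex

variable {V : Type*}

/-- The support of `w` lies in the cone over the octahedron with antipodal pairs `xᵢ, yᵢ` if it
lies in the vertex set and contains no antipodal pair. -/
theorem mem_realization_cone_octahedron [DecidableEq V] [Fintype V] {v x₁ x₂ x₃ y₁ y₂ y₃ : V}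
    (hne : [v, x₁, x₂, x₃, y₁, y₂, y₃].Nodup) {w : V → ℝ} :
    w ∈ (cone v (octahedron x₁ x₂ x₃ y₁ y₂ y₃)).realization ↔ w ∈ stdSimplex ℝ V ∧
      (∀ u, u ∉ [v, x₁, x₂, x₃, y₁, y₂, y₃] → w u = 0) ∧
        w x₁ * w y₁ = 0 ∧ w x₂ * w y₂ = 0 ∧ w x₃ * w y₃ = 0 := by
  rw [cone_octahedron_eq_ofLists, mem_realization_ofLists]
  refine and_congr_right fun _ => ⟨?_, ?_⟩
  · rintro ⟨l, hl, hw⟩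
    simp only [List.nodup_cons, List.mem_cons, List.not_mem_nil, or_false, not_or] at hl hne
    have mul_zero_of : ∀ {x y}, x ∉ l ∨ y ∉ l → w x * w y = 0 := fun {x y} h =>
      mul_eq_zero.2 (h.imp (hw x) (hw y))
    have hsub : l ⊆ [v, x₁, x₂, x₃, y₁, y₂, y₃] := by
      rcases hl with rfl | rfl | rfl | rfl | rfl | rfl | rfl | rfl <;> simp
    have hpair : (x₁ ∉ l ∨ y₁ ∉ l) ∧ (x₂ ∉ l ∨ y₂ ∉ l) ∧ (x₃ ∉ l ∨ y₃ ∉ l) := by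
      clear hw mul_zero_of hsub
      rcases hl with rfl | rfl | rfl | rfl | rfl | rfl | rfl | rfl <;>
        simp only [List.mem_cons, List.not_mem_nil, or_false] <;> grind
    exact ⟨fun u hu => hw u fun h => hu (hsub h), mul_zero_of hpair.1, mul_zero_of hpair.2.1,
      mul_zero_of hpair.2.2⟩
  · rintro ⟨hw, h₁, h₂, h₃⟩
    have key : ∀ l : List V, (∀ u ∈ [v, x₁, x₂, x₃, y₁, y₂, y₃], u ∉ l → w u = 0) →
        ∀ u, u ∉ l → w u = 0 := fun l hl u hu =>
      (em (u ∈ [v, x₁, x₂, x₃, y₁, y₂, y₃])).elim (fun h => hl u h hu) (hw u)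
    rcases mul_eq_zero.1 h₁ with h₁ | h₁ <;> rcases mul_eq_zero.1 h₂ with h₂ | h₂ <;>
      rcases mul_eq_zero.1 h₃ with h₃ | h₃
    · exact ⟨[v, y₁, y₂, y₃], by simp, key _ (by simp [h₁, h₂, h₃])⟩
    · exact ⟨[v, y₁, y₂, x₃], by simp, key _ (by simp [h₁, h₂, h₃])⟩
    · exact ⟨[v, y₁, x₂, y₃], by simp, key _ (by simp [h₁, h₂, h₃])⟩
    · exact ⟨[v, y₁, x₂, x₃], by simp, key _ (by simp [h₁, h₂, h₃])⟩
    · exact ⟨[v, x₁, y₂, y₃], by simp, key _ (by simp [h₁, h₂, h₃])⟩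
    · exact ⟨[v, x₁, y₂, x₃], by simp, key _ (by simp [h₁, h₂, h₃])⟩
    · exact ⟨[v, x₁, x₂, y₃], by simp, key _ (by simp [h₁, h₂, h₃])⟩
    · exact ⟨[v, x₁, x₂, x₃], by simp, key _ (by simp [h₁, h₂, h₃])⟩

/-- The support of `w` lies in the staircase triangulation of the prism over the triangle `abc`
if it lies in the vertex set and contains none of the pairs `cb'`, `ca'`, `ba'`. -/
theorem exists_mem_staircase_iff {a b c a' b' c' : V} (hne : [a, b, c, a', b', c'].Nodup)
    {w : V → ℝ} :
    (∃ l ∈ [[a, b, c, c'], [a, b, b', c'], [a, a', b', c']], ∀ v, v ∉ l → w v = 0) ↔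
      (∀ v, v ∉ [a, b, c, a', b', c'] → w v = 0) ∧
        w c * w b' = 0 ∧ w c * w a' = 0 ∧ w b * w a' = 0 := by
  constructor
  · rintro ⟨l, hl, hw⟩
    simp only [List.nodup_cons, List.mem_cons, List.not_mem_nil, or_false, not_or] at hl hne
    have mul_zero_of : ∀ {x y}, x ∉ l ∨ y ∉ l → w x * w y = 0 := fun {x y} h =>
      mul_eq_zero.2 (h.imp (hw x) (hw y))
    have hsub : l ⊆ [a, b, c, a', b', c'] := by
      rcases hl with rfl | rfl | rfl <;> simp
    have hpair : (c ∉ l ∨ b' ∉ l) ∧ (c ∉ l ∨ a' ∉ l) ∧ (b ∉ l ∨ a' ∉ l) := by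
      clear hw mul_zero_of hsub
      rcases hl with rfl | rfl | rfl <;>
        simp only [List.mem_cons, List.not_mem_nil, or_false] <;> grind
    exact ⟨fun u hu => hw u fun h => hu (hsub h), mul_zero_of hpair.1, mul_zero_of hpair.2.1,
      mul_zero_of hpair.2.2⟩
  · rintro ⟨hw, h₁, h₂, h₃⟩
    have key : ∀ l : List V, (∀ u ∈ [a, b, c, a', b', c'], u ∉ l → w u = 0) →
        ∀ u, u ∉ l → w u = 0 := fun l hl u hu =>
      (em (u ∈ [a, b, c, a', b', c'])).elim (fun h => hl u h hu) (hw u)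
    rcases em (w c = 0) with hc | hc
    · rcases mul_eq_zero.1 h₃ with hb | ha
      · exact ⟨[a, a', b', c'], by simp, key _ (by simp [hc, hb])⟩
      · exact ⟨[a, b, b', c'], by simp, key _ (by simp [hc, ha])⟩
    · have hb := (mul_eq_zero.1 h₁).resolve_left hc
      have ha := (mul_eq_zero.1 h₂).resolve_left hc
      exact ⟨[a, b, c, c'], by simp, key _ (by simp [hb, ha])⟩

end PreAbstractSimplicialComplex

namespace FlagThreeSphere

open PreAbstractSimplicialComplex

section
open Vertex

/-- The vertices `φ(aᵢ)`, in cyclic order. -/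
def colA : Fin 3 → Vertex := ![z2, z3, z1]

/-- The vertices `φ(bᵢ)`, in cyclic order. -/
def colB : Fin 3 → Vertex := ![y3, y1, y2]

/-- The vertices `φ(cᵢ)`, in cyclic order. -/
def colC : Fin 3 → Vertex := ![x1, x2, x3]

theorem forall_vertex {P : Vertex → Prop} :
    (∀ v, P v) ↔ (P v1 ∧ P v2 ∧ P v3) ∧ (∀ i, P (colA i)) ∧ (∀ i, P (colB i)) ∧
      ∀ i, P (colC i) := by
  simp only [Fin.forall_fin_succ, colA, colB, colC]
  constructor
  · intro h
    simp [h]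
  · rintro h v
    cases v <;> simp_all

theorem sum_vertex (w : Vertex → ℝ) :
    ∑ v, w v = w v1 + w v2 + w v3 + ∑ i, w (colA i) + ∑ i, w (colB i) + ∑ i, w (colC i) := by
  have h : (Finset.univ : Finset Vertex) = {v1, v2, v3, x1, x2, x3, y1, y2, y3, z1, z2, z3} := rfl
  rw [h]
  simp [Fin.sum_univ_three, colA, colB, colC]
  ring

/-- `w` is supported on the cone with apex `v` over the octahedron with opposite triangles `P` and
`Q`, in which `P i` is antipodal to `Q (i + 1)`; the remaining vertices are `u`, `t` and `R i`. -/
structure SupportedOnCone (w : Vertex → ℝ) (u t : Vertex) (P Q R : Fin 3 → Vertex) :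
    Prop where
  left : w u = 0
  right : w t = 0
  rest : ∀ i, w (R i) = 0
  antipodal : ∀ i, w (P i) * w (Q (i + 1)) = 0

/-- `w` is supported on a face of the solid torus `Γ₂`: it vanishes at the apexes `v₁, v₂, v₃`
and at one of the three levels, and its support at the other two levels follows the staircase
pattern. -/
structure SupportedOnStaircase (w : Vertex → ℝ) (i : Fin 3) : Prop where
  apex₁ : w v1 = 0
  apex₂ : w v2 = 0
  apex₃ : w v3 = 0
  missing : w (colA (i + 2)) = 0 ∧ w (colB (i + 2)) = 0 ∧ w (colC (i + 2)) = 0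
  staircase : w (colC i) * w (colB (i + 1)) = 0 ∧ w (colC i) * w (colA (i + 1)) = 0 ∧
    w (colB i) * w (colA (i + 1)) = 0

theorem supportedOnCone_iff {w : Vertex → ℝ} {u t : Vertex} {P Q R : Fin 3 → Vertex} :
    SupportedOnCone w u t P Q R ↔
      w u = 0 ∧ w t = 0 ∧ (∀ i, w (R i) = 0) ∧ ∀ i, w (P i) * w (Q (i + 1)) = 0 :=
  ⟨fun ⟨h₁, h₂, h₃, h₄⟩ => ⟨h₁, h₂, h₃, h₄⟩, fun ⟨h₁, h₂, h₃, h₄⟩ => ⟨h₁, h₂, h₃, h₄⟩⟩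

theorem supportedOnStaircase_iff {w : Vertex → ℝ} {i : Fin 3} :
    SupportedOnStaircase w i ↔ (w v1 = 0 ∧ w v2 = 0 ∧ w v3 = 0) ∧
      (w (colA (i + 2)) = 0 ∧ w (colB (i + 2)) = 0 ∧ w (colC (i + 2)) = 0) ∧
      w (colC i) * w (colB (i + 1)) = 0 ∧ w (colC i) * w (colA (i + 1)) = 0 ∧
        w (colB i) * w (colA (i + 1)) = 0 :=
  ⟨fun ⟨h₁, h₂, h₃, h₄, h₅⟩ => ⟨⟨h₁, h₂, h₃⟩, h₄, h₅⟩,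
    fun ⟨⟨h₁, h₂, h₃⟩, h₄, h₅⟩ => ⟨h₁, h₂, h₃, h₄, h₅⟩⟩

theorem mem_realization_Gamma1 {w : Vertex → ℝ} :
    w ∈ Gamma1.realization ↔ w ∈ stdSimplex ℝ Vertex ∧
      (SupportedOnCone w v2 v3 colC colB colA ∨ SupportedOnCone w v1 v3 colB colA colC ∨
        SupportedOnCone w v1 v2 colC colA colB) := by
  rw [Gamma1, realization_sup, realization_sup, Set.mem_union, Set.mem_union,
    mem_realization_cone_octahedron (by decide), mem_realization_cone_octahedron (by decide),
    mem_realization_cone_octahedron (by decide), ← and_or_left, ← and_or_left, or_assoc]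
  refine and_congr_right fun _ => or_congr ?_ (or_congr ?_ ?_)
  all_goals
    rw [forall_vertex, supportedOnCone_iff]
    simp [Fin.forall_fin_succ, colA, colB, colC, -mul_eq_zero]
    tauto

theorem mem_realization_Gamma2 {w : Vertex → ℝ} :
    w ∈ Gamma2.realization ↔ w ∈ stdSimplex ℝ Vertex ∧ ∃ i, SupportedOnStaircase w i := by
  have h : gamma2Facets = [[z2, y3, x1, x2], [z2, y3, y1, x2], [z2, z3, y1, x2]] ++
      ([[z3, y1, x2, x3], [z3, y1, y2, x3], [z3, z1, y2, x3]] ++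
        [[z1, y2, x3, x1], [z1, y2, y3, x1], [z1, z2, y3, x1]]) := rfl
  rw [Gamma2_eq_ofLists, mem_realization_ofLists, h]
  simp only [List.mem_append, or_and_right, exists_or]
  rw [exists_mem_staircase_iff (by decide), exists_mem_staircase_iff (by decide),
    exists_mem_staircase_iff (by decide)]
  rw [Fin.exists_fin_succ, Fin.exists_fin_two]
  refine and_congr_right fun _ => or_congr ?_ (or_congr ?_ ?_)
  all_goals
    rw [forall_vertex, supportedOnStaircase_iff]
    simp [Fin.forall_fin_succ, colA, colB, colC, -mul_eq_zero]
    tauto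

end

end FlagThreeSphere

/-! ### The homeomorphism onto the boundary of a product of two triangles -/

namespace FlagThreeSphere

open PreAbstractSimplicialComplex

section
open Vertex

/-- The coordinate `a` of the image of `w` in the triangle `abc`. The apexes `v₁, v₂, v₃` lie over
the midpoints of the edges `bc`, `ab`, `ac`. -/
noncomputable def weightA (w : Vertex → ℝ) : ℝ := ∑ i, w (colA i) + w v2 / 2 + w v3 / 2

/-- The coordinate `b` of the image of `w` in the triangle `abc`. -/
noncomputable def weightB (w : Vertex → ℝ) : ℝ := ∑ i, w (colB i) + w v1 / 2 + w v2 / 2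

/-- The coordinate `c` of the image of `w` in the triangle `abc`. -/
noncomputable def weightC (w : Vertex → ℝ) : ℝ := ∑ i, w (colC i) + w v1 / 2 + w v3 / 2

/-- The coordinate `i` of the image of `w` in the triangle `123`. The apexes `v₁, v₂, v₃` lie over
its barycentre. -/
noncomputable def level (w : Vertex → ℝ) (i : Fin 3) : ℝ :=
  w (colA i) + w (colB i) + w (colC i) + w v1 / 3 + w v2 / 3 + w v3 / 3

/-- The map, linear on each simplex, that takes `aᵢ, bᵢ, cᵢ` to the vertices of the product of the
triangles `abc` and `123`, and the three apexes to the barycentres of the products of an edge of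
`abc` with the triangle `123`. -/
noncomputable def toProduct (w : Vertex → ℝ) : EuclideanSpace ℝ (Fin 2) × EuclideanSpace ℝ (Fin 2) :=
  (!₂[weightA w, weightB w], !₂[level w 0, level w 1])

theorem continuous_toProduct : Continuous toProduct := by
  unfold toProduct weightA weightB level
  fun_prop

variable {w w' : Vertex → ℝ}

theorem weight_add (hw : w ∈ stdSimplex ℝ Vertex) : weightA w + weightB w + weightC w = 1 := by
  have h := hw.2
  rw [sum_vertex] at h
  rw [weightA, weightB, weightC]
  linarith

theorem level_add (hw : w ∈ stdSimplex ℝ Vertex) : level w 0 + level w 1 + level w 2 = 1 := by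
  have h := hw.2
  rw [sum_vertex] at h
  simp only [Fin.sum_univ_three] at h
  rw [level, level, level]
  linarith

theorem weightA_nonneg (hw : ∀ v, 0 ≤ w v) : 0 ≤ weightA w := by
  have := hw v2
  have := hw v3
  have := Finset.sum_nonneg fun i (_ : i ∈ Finset.univ) => hw (colA i)
  rw [weightA]
  positivity

theorem weightB_nonneg (hw : ∀ v, 0 ≤ w v) : 0 ≤ weightB w := by
  have := hw v1
  have := hw v2
  have := Finset.sum_nonneg fun i (_ : i ∈ Finset.univ) => hw (colB i)
  rw [weightB]
  positivity

theorem weightC_nonneg (hw : ∀ v, 0 ≤ w v) : 0 ≤ weightC w := by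
  have := hw v1
  have := hw v3
  have := Finset.sum_nonneg fun i (_ : i ∈ Finset.univ) => hw (colC i)
  rw [weightC]
  positivity

theorem level_nonneg (hw : ∀ v, 0 ≤ w v) (i : Fin 3) : 0 ≤ level w i := by
  have := hw v1
  have := hw v2
  have := hw v3
  have := hw (colA i)
  have := hw (colB i)
  have := hw (colC i)
  rw [level]
  positivity

theorem toProduct_mem (hw : w ∈ stdSimplex ℝ Vertex) :
    (toProduct w).1 ∈ triangle ∧ (toProduct w).2 ∈ triangle := by
  have h₁ := weight_add hw
  have h₂ := level_add hw
  have h₃ := weightC_nonneg hw.1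
  have h₄ := level_nonneg hw.1
  refine ⟨⟨weightA_nonneg hw.1, weightB_nonneg hw.1, ?_⟩, h₄ 0, h₄ 1, ?_⟩
  · change weightA w + weightB w ≤ 1
    linarith
  · change level w 0 + level w 1 ≤ 1
    linarith [h₄ 2]

theorem toProduct_fst_mem_frontier (hw : w ∈ stdSimplex ℝ Vertex)
    (h : weightA w = 0 ∨ weightB w = 0 ∨ weightC w = 0) :
    (toProduct w).1 ∈ frontier triangle := by
  rw [frontier_triangle]
  refine ⟨(toProduct_mem hw).1, h.imp id (Or.imp id fun h => ?_)⟩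
  change weightA w + weightB w = 1
  linarith [weight_add hw]

theorem toProduct_snd_mem_frontier (hw : w ∈ stdSimplex ℝ Vertex) {i : Fin 3}
    (h : level w i = 0) : (toProduct w).2 ∈ frontier triangle := by
  rw [frontier_triangle]
  refine ⟨(toProduct_mem hw).2, ?_⟩
  change level w 0 = 0 ∨ level w 1 = 0 ∨ level w 0 + level w 1 = 1
  have h' := level_add hw
  fin_cases i
  · exact Or.inl h
  · exact Or.inr (Or.inl h)
  · exact Or.inr (Or.inr (by simp only [Fin.reduceFinMk] at h; linarith))

theorem coordinates_eq_of_toProduct_eq (hw : w ∈ stdSimplex ℝ Vertex)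
    (hw' : w' ∈ stdSimplex ℝ Vertex) (h : toProduct w = toProduct w') :
    weightA w = weightA w' ∧ weightB w = weightB w' ∧ weightC w = weightC w' ∧
      ∀ i, level w i = level w' i := by
  have h₁ : weightA w = weightA w' := congrArg (fun x => x.1 0) h
  have h₂ : weightB w = weightB w' := congrArg (fun x => x.1 1) h
  have h₃ : level w 0 = level w' 0 := congrArg (fun x => x.2 0) h
  have h₄ : level w 1 = level w' 1 := congrArg (fun x => x.2 1) h
  have := weight_add hw
  have := weight_add hw'
  have := level_add hw
  have := level_add hw'
  refine ⟨h₁, h₂, by linarith, fun i => ?_⟩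
  fin_cases i
  · exact h₃
  · exact h₄
  · simp only [Fin.reduceFinMk]
    linarith

theorem weightA_eq_zero_iff (hw : ∀ v, 0 ≤ w v) :
    weightA w = 0 ↔ (∀ i, w (colA i) = 0) ∧ w v2 = 0 ∧ w v3 = 0 := by
  have h₂ := hw v2
  have h₃ := hw v3
  have h := fun i => hw (colA i)
  constructor
  · intro h₀
    rw [weightA, Fin.sum_univ_three] at h₀
    refine ⟨fun i => ?_, ?_, ?_⟩
    · fin_cases i <;> simp only [Fin.reduceFinMk] <;> linarith [h 0, h 1, h 2]
    all_goals linarith [h 0, h 1, h 2]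
  · rintro ⟨h, h₂, h₃⟩
    simp [weightA, h, h₂, h₃]

theorem weightB_eq_zero_iff (hw : ∀ v, 0 ≤ w v) :
    weightB w = 0 ↔ (∀ i, w (colB i) = 0) ∧ w v1 = 0 ∧ w v2 = 0 := by
  have h₁ := hw v1
  have h₂ := hw v2
  have h := fun i => hw (colB i)
  constructor
  · intro h₀
    rw [weightB, Fin.sum_univ_three] at h₀
    refine ⟨fun i => ?_, ?_, ?_⟩
    · fin_cases i <;> simp only [Fin.reduceFinMk] <;> linarith [h 0, h 1, h 2]
    all_goals linarith [h 0, h 1, h 2]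
  · rintro ⟨h, h₁, h₂⟩
    simp [weightB, h, h₁, h₂]

theorem weightC_eq_zero_iff (hw : ∀ v, 0 ≤ w v) :
    weightC w = 0 ↔ (∀ i, w (colC i) = 0) ∧ w v1 = 0 ∧ w v3 = 0 := by
  have h₁ := hw v1
  have h₃ := hw v3
  have h := fun i => hw (colC i)
  constructor
  · intro h₀
    rw [weightC, Fin.sum_univ_three] at h₀
    refine ⟨fun i => ?_, ?_, ?_⟩
    · fin_cases i <;> simp only [Fin.reduceFinMk] <;> linarith [h 0, h 1, h 2]
    all_goals linarith [h 0, h 1, h 2]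
  · rintro ⟨h, h₁, h₃⟩
    simp [weightC, h, h₁, h₃]

theorem level_eq_zero_iff (hw : ∀ v, 0 ≤ w v) (i : Fin 3) :
    level w i = 0 ↔ (w (colA i) = 0 ∧ w (colB i) = 0 ∧ w (colC i) = 0) ∧
      w v1 = 0 ∧ w v2 = 0 ∧ w v3 = 0 := by
  have h₁ := hw v1
  have h₂ := hw v2
  have h₃ := hw v3
  have hA := hw (colA i)
  have hB := hw (colB i)
  have hC := hw (colC i)
  constructor
  · intro h₀
    rw [level] at h₀
    refine ⟨⟨?_, ?_, ?_⟩, ?_, ?_, ?_⟩ <;> linarith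
  · rintro ⟨⟨hA, hB, hC⟩, h₁, h₂, h₃⟩
    simp [level, hA, hB, hC, h₁, h₂, h₃]

theorem mapsTo_Gamma1 :
    Set.MapsTo toProduct Gamma1.realization (frontier triangle ×ˢ triangle) := by
  intro w hw
  obtain ⟨hw, h⟩ := mem_realization_Gamma1.1 hw
  refine ⟨toProduct_fst_mem_frontier hw ?_, (toProduct_mem hw).2⟩
  rw [weightA_eq_zero_iff hw.1, weightB_eq_zero_iff hw.1, weightC_eq_zero_iff hw.1]
  rcases h with h | h | h
  · exact Or.inl ⟨h.rest, h.left, h.right⟩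
  · exact Or.inr (Or.inr ⟨h.rest, h.left, h.right⟩)
  · exact Or.inr (Or.inl ⟨h.rest, h.left, h.right⟩)

theorem mapsTo_Gamma2 :
    Set.MapsTo toProduct Gamma2.realization (triangle ×ˢ frontier triangle) := by
  intro w hw
  obtain ⟨hw, i, h⟩ := mem_realization_Gamma2.1 hw
  exact ⟨(toProduct_mem hw).1, toProduct_snd_mem_frontier hw
    ((level_eq_zero_iff hw.1 (i + 2)).2 ⟨h.missing, h.apex₁, h.apex₂, h.apex₃⟩)⟩

/-- Over the edge `bc` of the triangle `abc` only the cone with apex `v₁` matters. -/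
theorem supportedOnCone_of_weightA_eq_zero (hw : w ∈ Gamma1.realization) (h₀ : weightA w = 0) :
    SupportedOnCone w v2 v3 colC colB colA := by
  obtain ⟨hw, h⟩ := mem_realization_Gamma1.1 hw
  obtain ⟨hA, h₂, h₃⟩ := (weightA_eq_zero_iff hw.1).1 h₀
  rcases h with h | h | h
  · exact h
  · exact ⟨h₂, h₃, hA, fun i => by simp [h.rest]⟩
  · exact ⟨h₂, h₃, hA, fun i => by simp [h.rest]⟩

theorem supportedOnCone_of_weightC_eq_zero (hw : w ∈ Gamma1.realization) (h₀ : weightC w = 0) :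
    SupportedOnCone w v1 v3 colB colA colC := by
  obtain ⟨hw, h⟩ := mem_realization_Gamma1.1 hw
  obtain ⟨hC, h₁, h₃⟩ := (weightC_eq_zero_iff hw.1).1 h₀
  rcases h with h | h | h
  · exact ⟨h₁, h₃, hC, fun i => by simp [h.rest]⟩
  · exact h
  · exact ⟨h₁, h₃, hC, fun i => by simp [h.rest]⟩

theorem supportedOnCone_of_weightB_eq_zero (hw : w ∈ Gamma1.realization) (h₀ : weightB w = 0) :
    SupportedOnCone w v1 v2 colC colA colB := by
  obtain ⟨hw, h⟩ := mem_realization_Gamma1.1 hw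
  obtain ⟨hB, h₁, h₂⟩ := (weightB_eq_zero_iff hw.1).1 h₀
  rcases h with h | h | h
  · exact ⟨h₁, h₂, hB, fun i => by simp [h.rest]⟩
  · exact ⟨h₁, h₂, hB, fun i => by simp [h.rest]⟩
  · exact h

/-- Over the boundary of the triangle `123` the points of `Γ₁` also lie in `Γ₂`. -/
theorem supportedOnStaircase_of_level_eq_zero (hw : w ∈ Delta.realization) {i : Fin 3}
    (h₀ : level w (i + 2) = 0) : SupportedOnStaircase w i := by
  rw [Delta, realization_sup, Set.mem_union, mem_realization_Gamma1, mem_realization_Gamma2,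
    ← and_or_left] at hw
  obtain ⟨hw, h⟩ := hw
  obtain ⟨hm, h₁, h₂, h₃⟩ := (level_eq_zero_iff hw.1 _).1 h₀
  refine ⟨h₁, h₂, h₃, hm, ?_⟩
  rcases h with (h | h | h) | ⟨j, h⟩
  · exact ⟨h.antipodal i, by simp [h.rest], by simp [h.rest]⟩
  · exact ⟨by simp [h.rest], by simp [h.rest], h.antipodal i⟩
  · exact ⟨by simp [h.rest], h.antipodal i, by simp [h.rest]⟩
  · have hj := h.missing
    have hs := h.staircase
    -- for `j ≠ i` two levels are missing, and each product has a factor from one of them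
    fin_cases i <;> fin_cases j <;> simp only [Fin.reduceFinMk, Fin.reduceAdd, Fin.isValue] at * <;>
      simp_all

/-- Two points of `Γ₁` with the same image lie over the same edge of the triangle `abc`, hence in
the same cone. -/
theorem injOn_Gamma1 : Set.InjOn toProduct Gamma1.realization := by
  intro w hw w' hw' heq
  have hs := (mem_realization_Gamma1.1 hw).1
  have hs' := (mem_realization_Gamma1.1 hw').1
  have n := hs.1
  have n' := hs'.1
  obtain ⟨hA, hB, hC, hl⟩ := coordinates_eq_of_toProduct_eq hs hs' heq
  have hl' := hl
  have hA' := hA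
  have hB' := hB
  have hC' := hC
  simp only [weightA] at hA'
  simp only [weightB] at hB'
  simp only [weightC] at hC'
  simp only [level] at hl'
  rcases (mem_realization_Gamma1.1 hw).2 with h | h | h
  · have h' := supportedOnCone_of_weightA_eq_zero hw'
      (hA ▸ (weightA_eq_zero_iff n).2 ⟨h.rest, h.left, h.right⟩)
    simp only [h.rest, h.left, h.right, h'.rest, h'.left, h'.right] at hA' hB' hC' hl'
    obtain ⟨h₁, h₂, h₃⟩ := antiprism_unique (p := w ∘ colC) (q := w ∘ colB) (m := w v1)
      (p' := w' ∘ colC) (q' := w' ∘ colB) (m' := w' v1) (fun i => n _) (fun i => n _)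
      (fun i => n' _) (fun i => n' _) h.antipodal h'.antipodal (by simpa using hC')
      (by simpa using hB') (fun i => by simp only [Function.comp]; linarith [hl' i])
    refine funext (forall_vertex.2 ⟨⟨h₃, ?_, ?_⟩, fun i => ?_, h₂, h₁⟩)
    · rw [h.left, h'.left]
    · rw [h.right, h'.right]
    · rw [h.rest, h'.rest]
  · have h' := supportedOnCone_of_weightC_eq_zero hw'
      (hC ▸ (weightC_eq_zero_iff n).2 ⟨h.rest, h.left, h.right⟩)
    simp only [h.rest, h.left, h.right, h'.rest, h'.left, h'.right] at hA' hB' hC' hl'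
    obtain ⟨h₁, h₂, h₃⟩ := antiprism_unique (p := w ∘ colB) (q := w ∘ colA) (m := w v2)
      (p' := w' ∘ colB) (q' := w' ∘ colA) (m' := w' v2) (fun i => n _) (fun i => n _)
      (fun i => n' _) (fun i => n' _) h.antipodal h'.antipodal (by simpa using hB')
      (by simpa using hA') (fun i => by simp only [Function.comp]; linarith [hl' i])
    refine funext (forall_vertex.2 ⟨⟨?_, h₃, ?_⟩, h₂, h₁, fun i => ?_⟩)
    · rw [h.left, h'.left]
    · rw [h.right, h'.right]
    · rw [h.rest, h'.rest]
  · have h' := supportedOnCone_of_weightB_eq_zero hw'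
      (hB ▸ (weightB_eq_zero_iff n).2 ⟨h.rest, h.left, h.right⟩)
    simp only [h.rest, h.left, h.right, h'.rest, h'.left, h'.right] at hA' hB' hC' hl'
    obtain ⟨h₁, h₂, h₃⟩ := antiprism_unique (p := w ∘ colC) (q := w ∘ colA) (m := w v3)
      (p' := w' ∘ colC) (q' := w' ∘ colA) (m' := w' v3) (fun i => n _) (fun i => n _)
      (fun i => n' _) (fun i => n' _) h.antipodal h'.antipodal (by simpa using hC')
      (by simpa using hA') (fun i => by simp only [Function.comp]; linarith [hl' i])
    refine funext (forall_vertex.2 ⟨⟨?_, ?_, h₃⟩, h₂, fun i => ?_, h₁⟩)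
    · rw [h.left, h'.left]
    · rw [h.right, h'.right]
    · rw [h.rest, h'.rest]

theorem eq_of_supportedOnStaircase (hw : w ∈ stdSimplex ℝ Vertex)
    (hw' : w' ∈ stdSimplex ℝ Vertex) {i : Fin 3} (h : SupportedOnStaircase w i)
    (h' : SupportedOnStaircase w' i) (heq : toProduct w = toProduct w') : w = w' := by
  obtain ⟨hA, hB, hC, hl⟩ := coordinates_eq_of_toProduct_eq hw hw' heq
  have hsum : ∀ f : Fin 3 → ℝ, ∑ j, f j = f i + f (i + 1) + f (i + 2) := fun f => by
    rw [Fin.sum_univ_three]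
    fin_cases i <;> simp <;> ring
  have hforall : ∀ P : Fin 3 → Prop, P i → P (i + 1) → P (i + 2) → ∀ j, P j := fun P => by
    fin_cases i <;> (simp [Fin.forall_fin_succ]; tauto)
  obtain ⟨mA, mB, mC⟩ := h.missing
  obtain ⟨mA', mB', mC'⟩ := h'.missing
  obtain ⟨s₁, s₂, s₃⟩ := h.staircase
  obtain ⟨s₁', s₂', s₃'⟩ := h'.staircase
  have hl := hl (i + 1)
  simp only [weightA, weightB, weightC, level, hsum, h.apex₁, h.apex₂, h.apex₃, h'.apex₁,
    h'.apex₂, h'.apex₃, mA, mB, mC, mA', mB', mC', zero_div, add_zero] at hA hB hC hl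
  obtain ⟨⟨hA₀, hB₀, hC₀⟩, hA₁, hB₁, hC₁⟩ := staircase_unique (hw.1 _) (hw.1 _) (hw.1 _) (hw.1 _)
    (hw'.1 _) (hw'.1 _) (hw'.1 _) (hw'.1 _) s₁ s₂ s₃ s₁' s₂' s₃' hA hB hC hl
  exact funext (forall_vertex.2 ⟨⟨by rw [h.apex₁, h'.apex₁], by rw [h.apex₂, h'.apex₂],
    by rw [h.apex₃, h'.apex₃]⟩, hforall _ hA₀ hA₁ (by rw [mA, mA']),
    hforall _ hB₀ hB₁ (by rw [mB, mB']), hforall _ hC₀ hC₁ (by rw [mC, mC'])⟩)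

theorem injOn_Delta : Set.InjOn toProduct Delta.realization := by
  have mem_std : ∀ {w}, w ∈ Delta.realization → w ∈ stdSimplex ℝ Vertex := fun hw => hw.1
  -- the image of a point of `Γ₂` has a vanishing level, which forces both points into the same
  -- staircase prism
  have key : ∀ {w w'}, w ∈ Gamma2.realization → w' ∈ Delta.realization →
      toProduct w = toProduct w' → w = w' := by
    intro w w' hw hw' heq
    obtain ⟨hs, i, h⟩ := mem_realization_Gamma2.1 hw
    have hl := (coordinates_eq_of_toProduct_eq hs (mem_std hw') heq).2.2.2 (i + 2)
    refine eq_of_supportedOnStaircase hs (mem_std hw') h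
      (supportedOnStaircase_of_level_eq_zero hw' ?_) heq
    rw [← hl, level_eq_zero_iff hs.1]
    exact ⟨h.missing, h.apex₁, h.apex₂, h.apex₃⟩
  intro w hw w' hw' heq
  have hu := hw
  have hu' := hw'
  rw [Delta, realization_sup] at hu hu'
  rcases hu with h | h
  · rcases hu' with h' | h'
    · exact injOn_Gamma1 h h' heq
    · exact (key h' hw heq.symm).symm
  · exact key h hw' heq

/-- The function with values `m` at the apexes and `a`, `b`, `c` at the vertices `φ(aᵢ)`, `φ(bᵢ)`,
`φ(cᵢ)`. -/
def ofWeights (m a b c : Fin 3 → ℝ) : Vertex → ℝ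
  | v1 => m 0 | v2 => m 1 | v3 => m 2
  | z2 => a 0 | z3 => a 1 | z1 => a 2
  | y3 => b 0 | y1 => b 1 | y2 => b 2
  | x1 => c 0 | x2 => c 1 | x3 => c 2

theorem ofWeights_colA (m a b c : Fin 3 → ℝ) (i : Fin 3) : ofWeights m a b c (colA i) = a i := by
  fin_cases i <;> rfl

theorem ofWeights_colB (m a b c : Fin 3 → ℝ) (i : Fin 3) : ofWeights m a b c (colB i) = b i := by
  fin_cases i <;> rfl

theorem ofWeights_colC (m a b c : Fin 3 → ℝ) (i : Fin 3) : ofWeights m a b c (colC i) = c i := by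
  fin_cases i <;> rfl

/-- The weights sum to `1` as soon as the coordinates in the triangle `abc` do. -/
theorem mem_stdSimplex_of_weight_add (hw : ∀ v, 0 ≤ w v)
    (h : weightA w + weightB w + weightC w = 1) : w ∈ stdSimplex ℝ Vertex := by
  refine ⟨hw, ?_⟩
  rw [weightA, weightB, weightC] at h
  rw [sum_vertex]
  linarith

theorem toProduct_eq {x : EuclideanSpace ℝ (Fin 2) × EuclideanSpace ℝ (Fin 2)}
    (hA : weightA w = x.1 0) (hB : weightB w = x.1 1)
    (hl : ∀ i, level w i = ![x.2 0, x.2 1, 1 - x.2 0 - x.2 1] i) : toProduct w = x := by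
  refine Prod.ext (PiLp.ext fun i => ?_) (PiLp.ext fun i => ?_)
  · fin_cases i
    · exact hA
    · exact hB
  · fin_cases i
    · exact hl 0
    · exact hl 1

theorem surjOn_Gamma1 :
    Set.SurjOn toProduct Gamma1.realization (frontier triangle ×ˢ triangle) := by
  rintro x ⟨hp, hq₀, hq₁, hq₂⟩
  rw [frontier_triangle] at hp
  obtain ⟨⟨hp₀, hp₁, hp₂⟩, hp⟩ := hp
  have hβ : ∀ i, 0 ≤ ![x.2 0, x.2 1, 1 - x.2 0 - x.2 1] i := fun i => by
    fin_cases i <;> simp <;> linarith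
  have hβsum : 1 = ∑ i, ![x.2 0, x.2 1, 1 - x.2 0 - x.2 1] i := by
    simp [Fin.sum_univ_three]
  rcases hp with h₀ | h₀ | h₀
  · obtain ⟨c, b, m, hc, hb, hm, hcb, hC, hB, hl⟩ := exists_antiprism
      (P := 1 - x.1 1) (Q := x.1 1) (by linarith) hp₁ hβ (by linarith)
    set w := ofWeights ![m, 0, 0] 0 b c with hw
    have hn : ∀ v, 0 ≤ w v := forall_vertex.2 ⟨⟨hm, le_rfl, le_rfl⟩,
      fun i => by simp [hw, ofWeights_colA], fun i => by simp [hw, ofWeights_colB, hb],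
      fun i => by simp [hw, ofWeights_colC, hc]⟩
    have hwA : weightA w = x.1 0 := by
      simp [weightA, hw, ofWeights_colA, ofWeights, h₀]
    have hwB : weightB w = x.1 1 := by
      simp [weightB, hw, ofWeights_colB, ofWeights, hB]
    have hwC : weightC w = 1 - x.1 1 := by
      simp [weightC, hw, ofWeights_colC, ofWeights, hC]
    refine ⟨w, mem_realization_Gamma1.2 ⟨mem_stdSimplex_of_weight_add hn (by linarith),
      Or.inl ⟨rfl, rfl, fun i => by simp [hw, ofWeights_colA], fun i => ?_⟩⟩,
      toProduct_eq hwA hwB fun i => ?_⟩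
    · rw [hw, ofWeights_colB, ofWeights_colC, hcb]
    · rw [level, hw, ofWeights_colA, ofWeights_colB, ofWeights_colC, ← hl i]
      simp [ofWeights]
      ring
  · obtain ⟨c, a, m, hc, ha, hm, hca, hC, hA, hl⟩ := exists_antiprism
      (P := 1 - x.1 0) (Q := x.1 0) (by linarith) hp₀ hβ (by linarith)
    set w := ofWeights ![0, 0, m] a 0 c with hw
    have hn : ∀ v, 0 ≤ w v := forall_vertex.2 ⟨⟨le_rfl, le_rfl, hm⟩,
      fun i => by simp [hw, ofWeights_colA, ha], fun i => by simp [hw, ofWeights_colB],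
      fun i => by simp [hw, ofWeights_colC, hc]⟩
    have hwA : weightA w = x.1 0 := by
      simp [weightA, hw, ofWeights_colA, ofWeights, hA]
    have hwB : weightB w = x.1 1 := by
      simp [weightB, hw, ofWeights_colB, ofWeights, h₀]
    have hwC : weightC w = 1 - x.1 0 := by
      simp [weightC, hw, ofWeights_colC, ofWeights, hC]
    refine ⟨w, mem_realization_Gamma1.2 ⟨mem_stdSimplex_of_weight_add hn (by linarith),
      Or.inr (Or.inr ⟨rfl, rfl, fun i => by simp [hw, ofWeights_colB], fun i => ?_⟩)⟩,
      toProduct_eq hwA hwB fun i => ?_⟩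
    · rw [hw, ofWeights_colA, ofWeights_colC, hca]
    · rw [level, hw, ofWeights_colA, ofWeights_colB, ofWeights_colC, ← hl i]
      simp [ofWeights]
      ring
  · obtain ⟨b, a, m, hb, ha, hm, hba, hB, hA, hl⟩ := exists_antiprism
      (P := x.1 1) (Q := x.1 0) hp₁ hp₀ hβ (by linarith)
    set w := ofWeights ![0, m, 0] a b 0 with hw
    have hn : ∀ v, 0 ≤ w v := forall_vertex.2 ⟨⟨le_rfl, hm, le_rfl⟩,
      fun i => by simp [hw, ofWeights_colA, ha], fun i => by simp [hw, ofWeights_colB, hb],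
      fun i => by simp [hw, ofWeights_colC]⟩
    have hwA : weightA w = x.1 0 := by
      simp [weightA, hw, ofWeights_colA, ofWeights, hA]
    have hwB : weightB w = x.1 1 := by
      simp [weightB, hw, ofWeights_colB, ofWeights, hB]
    have hwC : weightC w = 0 := by
      simp [weightC, hw, ofWeights_colC, ofWeights]
    refine ⟨w, mem_realization_Gamma1.2 ⟨mem_stdSimplex_of_weight_add hn (by linarith),
      Or.inr (Or.inl ⟨rfl, rfl, fun i => by simp [hw, ofWeights_colC], fun i => ?_⟩)⟩,
      toProduct_eq hwA hwB fun i => ?_⟩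
    · rw [hw, ofWeights_colA, ofWeights_colB, hba]
    · rw [level, hw, ofWeights_colA, ofWeights_colB, ofWeights_colC, ← hl i]
      simp [ofWeights]
      ring

/-- The weights over the edge `i, i + 1` of the triangle `123` are those of a staircase prism,
shifted by `i`. -/
theorem surjOn_Gamma2 :
    Set.SurjOn toProduct Gamma2.realization (triangle ×ˢ frontier triangle) := by
  rintro x ⟨⟨hp₀, hp₁, hp₂⟩, hq⟩
  rw [frontier_triangle] at hq
  obtain ⟨⟨hq₀, hq₁, hq₂⟩, hq⟩ := hq
  set β : Fin 3 → ℝ := ![x.2 0, x.2 1, 1 - x.2 0 - x.2 1] with hβ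
  have hβn : ∀ i, 0 ≤ β i := fun i => by
    fin_cases i <;> simp [hβ] <;> linarith
  obtain ⟨i, hi⟩ : ∃ i, β (i + 2) = 0 := by
    rcases hq with h | h | h
    · exact ⟨1, h⟩
    · exact ⟨2, h⟩
    · exact ⟨0, by simp [hβ]; linarith⟩
  have hβsum : β i + β (i + 1) = 1 := by
    have h : β i + β (i + 1) + β (i + 2) = 1 := by
      fin_cases i <;> simp [hβ]
      ring
    linarith
  obtain ⟨a₀, a₁, b₀, b₁, c₀, c₁, ⟨ha₀, ha₁, hb₀, hb₁, hc₀, hc₁⟩, hs, hA, hB, hC, ht⟩ :=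
    exists_staircase (A := x.1 0) (B := x.1 1) (C := 1 - x.1 0 - x.1 1) (t := β (i + 1))
      hp₀ hp₁ (by linarith) (hβn _) (by linarith [hβn i])
  have hrot : ∀ f : Fin 3 → ℝ, ∑ j, f (j - i) = f 0 + f 1 + f 2 := fun f => by
    rw [← Fin.sum_univ_three]
    exact Equiv.sum_comp (Equiv.subRight i) f
  have hn : ∀ {s t : ℝ}, 0 ≤ s → 0 ≤ t → ∀ j, 0 ≤ (![s, t, 0] : Fin 3 → ℝ) j :=
    fun hs ht j => by fin_cases j <;> simp [hs, ht]
  set w := ofWeights 0 (fun j => ![a₀, a₁, 0] (j - i)) (fun j => ![b₀, b₁, 0] (j - i))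
    (fun j => ![c₀, c₁, 0] (j - i)) with hw
  have hwn : ∀ v, 0 ≤ w v := forall_vertex.2 ⟨⟨le_rfl, le_rfl, le_rfl⟩,
    fun j => by rw [hw, ofWeights_colA]; exact hn ha₀ ha₁ _,
    fun j => by rw [hw, ofWeights_colB]; exact hn hb₀ hb₁ _,
    fun j => by rw [hw, ofWeights_colC]; exact hn hc₀ hc₁ _⟩
  have hwA : weightA w = x.1 0 := by
    simp only [weightA, hw, ofWeights_colA, hrot]
    simp [ofWeights, hA]
  have hwB : weightB w = x.1 1 := by
    simp only [weightB, hw, ofWeights_colB, hrot]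
    simp [ofWeights, hB]
  have hwC : weightC w = 1 - x.1 0 - x.1 1 := by
    simp only [weightC, hw, ofWeights_colC, hrot]
    simp [ofWeights, hC]
  refine ⟨w, mem_realization_Gamma2.2 ⟨mem_stdSimplex_of_weight_add hwn (by linarith),
    i, rfl, rfl, rfl, ?_, ?_⟩, toProduct_eq hwA hwB fun j => ?_⟩
  · simp [hw, ofWeights_colA, ofWeights_colB, ofWeights_colC]
  · simpa [hw, ofWeights_colA, ofWeights_colB, ofWeights_colC] using hs
  · obtain ⟨k, rfl⟩ : ∃ k, j = k + i := ⟨j - i, by simp⟩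
    rw [level, hw, ofWeights_colA, ofWeights_colB, ofWeights_colC, ← hβ, add_sub_cancel_right]
    fin_cases k <;> simp [ofWeights, add_comm _ i, hi] <;> linarith

theorem bijOn_Gamma1 :
    Set.BijOn toProduct Gamma1.realization (frontier triangle ×ˢ triangle) :=
  ⟨mapsTo_Gamma1, injOn_Gamma1, surjOn_Gamma1⟩

theorem bijOn_Gamma2 :
    Set.BijOn toProduct Gamma2.realization (triangle ×ˢ frontier triangle) :=
  ⟨mapsTo_Gamma2, injOn_Delta.mono (by rw [Delta, realization_sup]; exact Set.subset_union_right),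
    surjOn_Gamma2⟩

theorem bijOn_Delta :
    Set.BijOn toProduct Delta.realization (frontier (triangle ×ˢ triangle)) := by
  have h : frontier (triangle ×ˢ triangle) =
      frontier triangle ×ˢ triangle ∪ triangle ×ˢ frontier triangle := by
    rw [frontier_prod_eq, isCompact_triangle.isClosed.closure_eq, Set.union_comm]
  have hinj := injOn_Delta
  rw [h]
  rw [Delta, realization_sup] at hinj ⊢
  exact bijOn_Gamma1.union bijOn_Gamma2 hinj

end

theorem Gamma1_isTriangulatedSolidTorus : Gamma1.IsTriangulatedSolidTorus := by
  obtain ⟨⟨e⟩, ⟨e'⟩⟩ := convex_triangle.nonempty_homeomorph_closedBall_sphere (n := 2) (by simp)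
    isCompact_triangle interior_triangle_nonempty
  obtain ⟨f⟩ := bijOn_Gamma1.nonempty_homeomorph_of_isCompact continuous_toProduct
    (isCompact_realization _)
  exact ⟨f.trans ((Homeomorph.Set.prod _ _).trans
    ((Homeomorph.prodComm _ _).trans (e.prodCongr e')))⟩

theorem Gamma2_isTriangulatedSolidTorus : Gamma2.IsTriangulatedSolidTorus := by
  obtain ⟨⟨e⟩, ⟨e'⟩⟩ := convex_triangle.nonempty_homeomorph_closedBall_sphere (n := 2) (by simp)
    isCompact_triangle interior_triangle_nonempty
  obtain ⟨f⟩ := bijOn_Gamma2.nonempty_homeomorph_of_isCompact continuous_toProduct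
    (isCompact_realization _)
  exact ⟨f.trans ((Homeomorph.Set.prod _ _).trans (e.prodCongr e'))⟩

theorem Delta_isSimplicialSphere : Delta.IsSimplicialSphere 3 := by
  obtain ⟨-, ⟨e⟩⟩ := (convex_triangle.prod convex_triangle).nonempty_homeomorph_closedBall_sphere
    (n := 3 + 1) (by simp) (isCompact_triangle.prod isCompact_triangle)
    (by rw [interior_prod_eq]; exact interior_triangle_nonempty.prod interior_triangle_nonempty)
  obtain ⟨f⟩ := bijOn_Delta.nonempty_homeomorph_of_isCompact continuous_toProduct
    (isCompact_realization _)
  exact ⟨f.trans e⟩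

end FlagThreeSphere

theorem mainTheorem3 :
    -- `Δ` is a flag simplicial 3-sphere
    FlagThreeSphere.Delta.IsSimplicialSphere 3 ∧
    FlagThreeSphere.Delta.IsFlag ∧
    -- `Δ = Γ₁ ∪ Γ₂` is two triangulated solid tori glued along their common boundary
    FlagThreeSphere.Gamma1.IsTriangulatedSolidTorus ∧
    FlagThreeSphere.Gamma2.IsTriangulatedSolidTorus ∧
    FlagThreeSphere.Delta = FlagThreeSphere.Gamma1 ⊔ FlagThreeSphere.Gamma2 ∧
    FlagThreeSphere.Gamma1 ⊓ FlagThreeSphere.Gamma2 = FlagThreeSphere.Gamma1.boundary ∧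
    FlagThreeSphere.Gamma1.boundary = FlagThreeSphere.Gamma2.boundary ∧
    -- the numbers of vertices and facets
    FlagThreeSphere.Delta.vertexSet.ncard = 12 ∧
    FlagThreeSphere.Delta.facets.ncard = 33 := by
  exact ⟨FlagThreeSphere.Delta_isSimplicialSphere, FlagThreeSphere.Delta_isFlag,
    FlagThreeSphere.Gamma1_isTriangulatedSolidTorus,
    FlagThreeSphere.Gamma2_isTriangulatedSolidTorus, rfl,
    FlagThreeSphere.Gamma1_inf_Gamma2.trans FlagThreeSphere.Gamma1_boundary.symm,
    FlagThreeSphere.Gamma1_boundary.trans FlagThreeSphere.Gamma2_boundary.symm,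
    FlagThreeSphere.ncard_Delta_vertexSet, FlagThreeSphere.ncard_Delta_facets⟩
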